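/- **Setting.** Let $0<a<b<2a$ and let $U:\mathbb R\to\mathbb R$ be continuous and even, with $U(y)=0$ for $|y|\ge b$, $U\in C^3((0,b))$, $U(a)=\min_{y\ge 0}U(y)$, and, for some $a_0\in(0,a)$ and $u_0>0$, $U''\ge u_0$ on $(a_0,b)$. Let $\tilde U:\mathbb R\to\mathbb R$ be continuous and even, with $\tilde U=U$ on $[-b,b]$, $\tilde U\in C^3((0,\infty))$ and $\tilde U''(y)\ge u_0$ for $|y|>a_0$. For $\varepsilon>0$ let $x^{\det}$ be the solution on $[0,b/a-1]$, with $0<x^{\det}_t<2a(1+t)$, of $$\dot x_t=-\frac1\varepsilon\,\partial_x\tilde H(x_t,t),\qquad x_0=a,\qquad \tilde H(x,t)=\tilde U(x)+\tilde U(2a(1+t)-x).$$ Put $d_+(t)=b-x^{\det}_t$, $d_-(t)=2a(1+t)-b-x^{\det}_t$, $A(t)=-\tilde U''(x^{\det}_t)-\tilde U''(2a(1+t)-x^{\det}_t)$ and $\alpha(t,s)=\int_s^tA(u)\,du$. Let $W$ be a standard Brownian motion. Let $\mathbb P^{t_0,y_0}$ denote the law of the continuous Gaussian process $y^0$ started from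 $y_0$ at time $t_0\in[0,b/a-1]$, $$y^0_t=e^{\alpha(t,t_0)/\varepsilon}y_0+\frac{\sigma}{\sqrt\varepsilon}\int_{t_0}^te^{\alpha(t,s)/\varepsilon}\,dW_s,\qquad t_0\le t\le b/a-1 .$$ Write $g(\sigma)\ll h(\sigma)$ if $g(\sigma)/h(\sigma)\to0$ as $\sigma\downarrow0$. Let $T=\inf\{t\in[0,b/a-1]:-d_-(t)-D^2=0\}$. **Proposition.** Let $\varepsilon,D,\Delta,f_+$ be positive functions of $\sigma$ with $$1\ll f_+\ll\sqrt{\varepsilon/\Delta}\ll\min(\sigma/D^2,\ \sigma/\varepsilon)\qquad\text{and}\qquad f_+\ll 1/\sigma .$$ Then for every function $f$ of $\sigma$ with $1/f_+(\sigma)\le f(\sigma)\le f_+(\sigma)$, and with $t^*=b/a-1-\sigma f(\sigma)/a$, we have: 1. $[t^*,t^*+\Delta]\subset[0,T]$ for all sufficiently small $\sigma>0$; 2. $\displaystyle\lim_{\sigma\downarrow0}\mathbb P^{t^*,-d_-(t^*)-D^2}\bigl\{y^0_t\ge d_+(t)+D^2\text{ for some }t\in[t^*,t^*+\Delta]\bigr\}=1$;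 3. $\displaystyle\lim_{\sigma\downarrow0}\mathbb P^{t^*,-d_-(t^*)-D^2}\Bigl\{\inf_{t^*\le t\le t^*+\Delta}y^0_t<0\Bigr\}=0$. -/

import Mathlib

open MeasureTheory ProbabilityTheory Filter Set Topology
open scoped NNReal ENNReal

namespace BreakingChain

/-- `g ≪ h`: the quotient `g(σ)/h(σ)` tends to `0` as `σ ↓ 0`. -/
def MuchLess (g h : ℝ → ℝ) : Prop :=
  Tendsto (fun σ => g σ / h σ) (𝓝[>] 0) (𝓝 0)

/-- The pair potential `U`: continuous and even, of range `b`, of class `C³` on `(0,b)`, minimal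
at `a`, and uniformly convex on `(a₀,b)` for some `a₀ ∈ (0,a)`. -/
structure IsPairPotential (U : ℝ → ℝ) (a b a₀ u₀ : ℝ) : Prop where
  continuous : Continuous U
  even : ∀ y, U (-y) = U y
  finite_range : ∀ y, b ≤ |y| → U y = 0
  contDiffOn : ContDiffOn ℝ 3 U (Ioo 0 b)
  a_lt_b : a < b
  b_lt : b < 2 * a
  isMin : ∀ y, 0 ≤ y → U a ≤ U y
  a₀_pos : 0 < a₀
  a₀_lt : a₀ < a
  u₀_pos : 0 < u₀
  convex : ∀ y ∈ Ioo a₀ b, u₀ ≤ deriv (deriv U) y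

/-- `V` is an even, continuous extension of `U` from `[-b,b]` to the line, of class `C³` on
`(0,∞)` and with `V'' ≥ u₀` wherever `|y| > a₀`. -/
structure IsConvexExtension (V U : ℝ → ℝ) (b a₀ u₀ : ℝ) : Prop where
  continuous : Continuous V
  contDiffOn : ContDiffOn ℝ 3 V (Ioi 0)
  eq_on : ∀ y, |y| ≤ b → V y = U y
  even : ∀ y, V (-y) = V y
  convex : ∀ y, a₀ < |y| → u₀ ≤ deriv (deriv V) y

/-- The energy of the middle particle at position `x`, at (rescaled) time `t`. -/
def energy (V : ℝ → ℝ) (a x t : ℝ) : ℝ := V x + V (2 * a * (1 + t) - x)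

/-- The time `b/a - 1` by which the chain is necessarily broken. -/
noncomputable def endTime (a b : ℝ) : ℝ := b / a - 1

/-- `x` solves `dx/dt = -(1/ε) ∂H/∂x (x,t)`, `x(0) = a`, on `[0, b/a - 1]`, strictly between the two
outer particles. -/
structure IsDetSolution (V : ℝ → ℝ) (a b ε : ℝ) (x : ℝ → ℝ) : Prop where
  init : x 0 = a
  between : ∀ t ∈ Icc 0 (endTime a b), x t ∈ Ioo 0 (2 * a * (1 + t))
  ode : ∀ t ∈ Icc 0 (endTime a b),
    HasDerivWithinAt x (-(1 / ε) * deriv (fun z => energy V a z t) (x t)) (Icc 0 (endTime a b)) t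

open Classical in
/-- The deterministic path `x^det`: the solution of the noiseless equation on `[0, b/a - 1]`.
(It is used only there, and only for `ε > 0`, where it exists and is unique.) -/
noncomputable def detPath (V : ℝ → ℝ) (a b ε : ℝ) : ℝ → ℝ :=
  if h : ∃ x, IsDetSolution V a b ε x then h.choose else fun _ => 0

/-- `A(t) = -V''(x^det_t) - V''(2a(1+t) - x^det_t)`. -/
noncomputable def drift (V : ℝ → ℝ) (a b ε t : ℝ) : ℝ :=
  -deriv (deriv V) (detPath V a b ε t)
    - deriv (deriv V) (2 * a * (1 + t) - detPath V a b ε t)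

/-- `α(t,s) = ∫ₛᵗ A(u) du`. -/
noncomputable def alpha (V : ℝ → ℝ) (a b ε t s : ℝ) : ℝ :=
  ∫ u in s..t, drift V a b ε u

/-- The boundary `d₊(t) = b - x^det_t`. -/
noncomputable def dPlus (V : ℝ → ℝ) (a b ε t : ℝ) : ℝ := b - detPath V a b ε t

/-- The boundary `d₋(t) = 2a(1+t) - b - x^det_t`. -/
noncomputable def dMinus (V : ℝ → ℝ) (a b ε t : ℝ) : ℝ :=
  2 * a * (1 + t) - b - detPath V a b ε t

/-- `T = inf {t ≥ 0 : -d₋(t) - D² = 0}`; the boundary curve lives on the time interval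
`[0, b/a - 1]`. -/
noncomputable def hitZero (V : ℝ → ℝ) (a b ε D : ℝ) : ℝ :=
  sInf {t | t ∈ Icc 0 (endTime a b) ∧ -dMinus V a b ε t - D ^ 2 = 0}

/-- The left-point Riemann sum of `∫ₛᵗ g dW` over `n` equal steps. -/
noncomputable def wienerSum {Ω : Type*} (W : ℝ≥0 → Ω → ℝ) (g : ℝ → ℝ) (s t : ℝ) (n : ℕ) (ω : Ω) :
    ℝ :=
  ∑ k ∈ Finset.range n, g (s + k * ((t - s) / n)) *
    (W (s + (k + 1) * ((t - s) / n)).toNNReal ω - W (s + k * ((t - s) / n)).toNNReal ω)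

/-- `Z = ∫ₛᵗ g dW`, the Wiener integral of a continuous deterministic integrand over an interval
`[s,t]` in `[0,∞)`: the limit in `L²` of the Riemann sums. -/
def IsWienerIntegral {Ω : Type*} [MeasurableSpace Ω] (W : ℝ≥0 → Ω → ℝ) (P : Measure Ω)
    (g : ℝ → ℝ) (s t : ℝ) (Z : Ω → ℝ) : Prop :=
  MemLp Z 2 P ∧ Tendsto (fun n => eLpNorm (wienerSum W g s t n - Z) 2 P) atTop (𝓝 0)

/-- `Y` is the process `y⁰` started at time `t₀` from `y₀`: it has continuous paths on
`[t₀, b/a - 1]`, and there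
`Y_t = e^{α(t,t₀)/ε} y₀ + (σ/√ε) ∫_{t₀}^t e^{α(t,s)/ε} dW_s` almost surely for every `t`. -/
structure IsGaussianPart {Ω : Type*} [MeasurableSpace Ω] (W : ℝ≥0 → Ω → ℝ) (P : Measure Ω)
    (V : ℝ → ℝ) (a b ε σ t₀ y₀ : ℝ) (Y : ℝ → Ω → ℝ) : Prop where
  continuous : ∀ᵐ ω ∂P, ContinuousOn (fun t => Y t ω) (Icc t₀ (endTime a b))
  formula : ∀ t ∈ Icc t₀ (endTime a b), ∃ Z : Ω → ℝ,
    IsWienerIntegral W P (fun s => Real.exp (alpha V a b ε t s / ε)) t₀ t Z ∧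
    ∀ᵐ ω ∂P, Y t ω = Real.exp (alpha V a b ε t t₀ / ε) * y₀ + σ / Real.sqrt ε * Z ω

/-- `t* = b/a - 1 - σ f / a`. -/
noncomputable def tStar (a b σ f : ℝ) : ℝ := b / a - 1 - σ * f / a

end BreakingChain

/-! Put `R = √(ε/Δ)`. Convexity keeps the deterministic path within `O(ε)` of the midpoint `a(1+t)`,
and `a(1+t*) = b - σf`. Hence the starting point `-d₋(t*) - D²` is `σf + O(ε + D²)`, while `d₊ + D²`
stays below `σf + O(ε + D²)` on the window. Over a time `Δ` the noise has size `σ√(Δ/ε) = σ/R`, and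
the hypotheses give `ε + D² ≪ σ/R ≪ σf`: the noise bridges the gap to the upper boundary but does
not reach down to zero. The drift factor is `1 + O(R⁻²)`, which moves the starting point by
`O(σf/R²) ≪ σ/R`, because `f ≤ f₊ ≪ R`.

The lower estimate is a maximal inequality. Once the factor `e^{α(t,t*)/ε}` is divided out, the
noise is a Wiener integral with an integrand independent of `t`. Kolmogorov's inequality for its
Riemann sums passes to the limit (`measure_exists_le_abs_wienerIntegral_dyadic`), and path
continuity extends it from dyadic times to the window; the probability is `O((Rf)⁻²)`.

For the upper estimate, `exists_measure_forall_increment_lt_le` observes Brownian motion at `K`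
geometrically spaced times after the start, where almost independent attempts to rise make failure
at all of them unlikely. At these finitely many times the noise integral is close to the Brownian
increment.

The window lies before `T` because at any zero of `-d₋ - D²` the midpoint is within `O(ε + D²)` of
`b`, and `σf` exceeds this by more than the distance `aΔ` that the midpoint travels during the
window. -/

namespace BreakingChain

/-! ### The deterministic path -/

/-- A solution of `x' = -(1/ε) (G x - G (2a(1+t) - x))` with `G' ≥ u₀` follows the midpoint
`a(1+t)` at distance at most `aε/u₀`. -/
lemma mem_tube_of_hasDerivWithinAt {G x : ℝ → ℝ} {a b ε u₀ p q : ℝ} (ha : 0 < a) (hu : 0 < u₀)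
    (hε : 0 < ε) (hp : p + a / u₀ * ε ≤ a) (hq : b + a / u₀ * ε ≤ q)
    (hG : ∀ y ∈ Icc p q, ∀ z ∈ Icc p q, y ≤ z → u₀ * (z - y) ≤ G z - G y)
    (hx0 : x 0 = a)
    (hode : ∀ t ∈ Icc 0 (endTime a b),
      HasDerivWithinAt x (-(1 / ε) * (G (x t) - G (2 * a * (1 + t) - x t)))
        (Icc 0 (endTime a b)) t) :
    ∀ t ∈ Icc 0 (endTime a b), a * (1 + t) - a / u₀ * ε ≤ x t ∧ x t ≤ a * (1 + t) := by
  have hc : 0 < a / u₀ * ε := by positivity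
  have hcont : ContinuousOn x (Icc 0 (endTime a b)) :=
    fun t ht => (hode t ht).continuousWithinAt
  have hIci : ∀ t ∈ Ico 0 (endTime a b),
      HasDerivWithinAt x (-(1 / ε) * (G (x t) - G (2 * a * (1 + t) - x t))) (Ici t) t :=
    fun t ht => (hode t ⟨ht.1, ht.2.le⟩).mono_of_mem_nhdsWithin (Icc_mem_nhdsGE_of_mem ht)
  have hline : ∀ t, HasDerivAt (fun t => a * (1 + t)) a t := fun t => by
    simpa using ((hasDerivAt_id t).const_add 1).const_mul a
  intro t ht
  constructor
  · have key := image_le_of_deriv_right_lt_deriv_boundary'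
      (f := fun t => a * (1 + t) - a / u₀ * ε)
      (f' := fun _ => a) (a := 0) (b := endTime a b) (by fun_prop)
      (fun t _ => ((hline t).sub_const _).hasDerivWithinAt)
      (B := x) (by simp only [hx0]; linarith) hcont hIci ?_ ht
    · exact key
    intro s hs hsx
    have hsb : a * (1 + s) ≤ b := by
      have := hs.2.le
      rw [endTime, le_sub_iff_add_le, le_div_iff₀ ha] at this
      linarith
    have has : 0 ≤ a * s := mul_nonneg ha.le hs.1
    -- Barrier argument: at a contact with the lower line the two distances differ by `2aε/u₀`, so
    -- convexity makes the speed at least `2a`, more than the slope `a` of the line. At a contact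
    -- with the midpoint the speed is `0`, less than `a`.
    have h1 : u₀ * ((2 * a * (1 + s) - x s) - x s) ≤ G (2 * a * (1 + s) - x s) - G (x s) := by
      apply hG
      · constructor <;> linarith
      · constructor <;> linarith
      · linarith
    have h2 : (2 * a * (1 + s) - x s) - x s = 2 * (a / u₀ * ε) := by rw [← hsx]; ring
    have h3 : u₀ * (2 * (a / u₀ * ε)) = 2 * a * ε := by field_simp
    rw [h2, h3] at h1
    have h4 : -(1 / ε) * (G (x s) - G (2 * a * (1 + s) - x s))
        = (G (2 * a * (1 + s) - x s) - G (x s)) / ε := by ring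
    rw [h4, lt_div_iff₀ hε]
    nlinarith
  · refine image_le_of_deriv_right_lt_deriv_boundary hcont hIci (B := fun t => a * (1 + t))
      (B' := fun _ => a) (by simp [hx0]) hline ?_ ht
    intro s hs hsx
    have : 2 * a * (1 + s) - x s = x s := by simp only [hsx]; ring
    rw [this]
    simpa using ha

section Potential

variable {U V : ℝ → ℝ} {a b a₀ u₀ : ℝ}

lemma IsConvexExtension.contDiffOn_deriv (hV : IsConvexExtension V U b a₀ u₀) :
    ContDiffOn ℝ 2 (deriv V) (Ioi 0) := by
  have h : ContDiffOn ℝ (2 + 1) V (Ioi 0) := by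
    have := hV.contDiffOn
    norm_num at this ⊢
    exact this
  exact ((contDiffOn_succ_iff_deriv_of_isOpen isOpen_Ioi).1 h).2.2

lemma IsConvexExtension.hasDerivAt (hV : IsConvexExtension V U b a₀ u₀) {y : ℝ} (hy : 0 < y) :
    HasDerivAt V (deriv V y) y :=
  ((hV.contDiffOn.differentiableOn (by norm_num)).differentiableAt
    (isOpen_Ioi.mem_nhds hy)).hasDerivAt

lemma IsConvexExtension.differentiableOn_deriv (hV : IsConvexExtension V U b a₀ u₀) :
    DifferentiableOn ℝ (deriv V) (Ioi 0) :=
  hV.contDiffOn_deriv.differentiableOn (by norm_num)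

lemma IsConvexExtension.continuousOn_deriv_deriv (hV : IsConvexExtension V U b a₀ u₀) :
    ContinuousOn (deriv (deriv V)) (Ioi 0) :=
  hV.contDiffOn_deriv.continuousOn_deriv_of_isOpen isOpen_Ioi (by norm_num)

lemma IsConvexExtension.mul_sub_le (hV : IsConvexExtension V U b a₀ u₀) (ha₀ : 0 < a₀)
    {y z : ℝ} (hy : a₀ < y) (hyz : y ≤ z) : u₀ * (z - y) ≤ deriv V z - deriv V y := by
  have hsub : Ioi a₀ ⊆ Ioi (0 : ℝ) := Ioi_subset_Ioi ha₀.le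
  refine (convex_Ioi a₀).mul_sub_le_image_sub_of_le_deriv
    (hV.differentiableOn_deriv.continuousOn.mono hsub)
    (by rw [interior_Ioi]; exact hV.differentiableOn_deriv.mono hsub) ?_ y hy z
    (lt_of_lt_of_le hy hyz) hyz
  intro w hw
  rw [interior_Ioi] at hw
  exact hV.convex w (lt_of_lt_of_le hw (le_abs_self w))

lemma IsConvexExtension.deriv_energy (hV : IsConvexExtension V U b a₀ u₀) {x t : ℝ} (hx : 0 < x)
    (hxt : x < 2 * a * (1 + t)) :
    deriv (fun z => energy V a z t) x = deriv V x - deriv V (2 * a * (1 + t) - x) := by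
  have h1 := hV.hasDerivAt hx
  have h2 : HasDerivAt (fun z => V (2 * a * (1 + t) - z))
      (deriv V (2 * a * (1 + t) - x) * (-1)) x :=
    (hV.hasDerivAt (sub_pos.2 hxt)).comp x ((hasDerivAt_id x).const_sub _)
  have := (h1.add h2).deriv
  simp only [energy]
  rw [show (fun z => V z + V (2 * a * (1 + t) - z)) = V + fun z => V (2 * a * (1 + t) - z) from rfl,
    this]
  ring

lemma mul_one_add_le_of_le_endTime (ha : 0 < a) {t : ℝ} (ht : t ≤ endTime a b) :
    a * (1 + t) ≤ b := by
  rw [endTime, le_sub_iff_add_le, le_div_iff₀ ha] at ht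
  linarith

lemma IsDetSolution.mem_tube (hV : IsConvexExtension V U b a₀ u₀) (ha₀ : 0 < a₀) (ha : a₀ < a)
    (hu : 0 < u₀) {ε : ℝ} (hε : 0 < ε) (hεa : a / u₀ * ε ≤ (a - a₀) / 2) {x : ℝ → ℝ}
    (hx : IsDetSolution V a b ε x) :
    ∀ t ∈ Icc 0 (endTime a b), a * (1 + t) - a / u₀ * ε ≤ x t ∧ x t ≤ a * (1 + t) := by
  refine mem_tube_of_hasDerivWithinAt (G := deriv V) (p := (a + a₀) / 2)
    (q := b + a / u₀ * ε) (ha₀.trans ha) hu hε (by linarith) le_rfl ?_ hx.init ?_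
  · intro y hy z _ hyz
    exact hV.mul_sub_le ha₀ (by linarith [hy.1]) hyz
  · intro t ht
    have hb := hx.between t ht
    rw [← hV.deriv_energy hb.1 hb.2]
    exact hx.ode t ht

/-- The field may be singular at the outer particles, so `V'` is frozen outside `[p, q]`, which
makes it bounded and Lipschitz. The tube estimate holds for the truncated equation too and keeps `x`
and its mirror image in `[p, q]`, where truncation changes nothing. -/
lemma IsConvexExtension.exists_isDetSolution (hV : IsConvexExtension V U b a₀ u₀) (ha₀ : 0 < a₀)
    (ha : a₀ < a) (hab : a < b) (hu : 0 < u₀) {ε : ℝ} (hε : 0 < ε)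
    (hεa : a / u₀ * ε ≤ (a - a₀) / 2) : ∃ x, IsDetSolution V a b ε x := by
  have hapos : 0 < a := ha₀.trans ha
  have hT : 0 ≤ endTime a b := by
    rw [endTime, sub_nonneg, le_div_iff₀ hapos]; linarith
  have hεinv : 0 < 1 / ε := by positivity
  set p := (a + a₀) / 2 with hp
  set q := b + a / u₀ * ε with hq
  have hppos : 0 < p := by rw [hp]; linarith
  have hc : 0 < a / u₀ * ε := by positivity
  have hpq : p ≤ q := by rw [hp, hq]; linarith
  have hsub : Icc p q ⊆ Ioi 0 := fun y hy => lt_of_lt_of_le hppos hy.1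
  obtain ⟨C, hC⟩ := isCompact_Icc.exists_bound_of_continuousOn
    (hV.differentiableOn_deriv.continuousOn.mono hsub)
  obtain ⟨K, hK⟩ := isCompact_Icc.exists_bound_of_continuousOn
    (hV.continuousOn_deriv_deriv.mono hsub)
  have hC0 : 0 ≤ C := (norm_nonneg _).trans (hC p ⟨le_rfl, hpq⟩)
  have hK0 : 0 ≤ K := (norm_nonneg _).trans (hK p ⟨le_rfl, hpq⟩)
  have hLip : LipschitzOnWith K.toNNReal (deriv V) (Icc p q) :=
    (convex_Icc p q).lipschitzOnWith_of_nnnorm_deriv_le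
      (fun y hy => hV.differentiableOn_deriv.differentiableAt (isOpen_Ioi.mem_nhds (hsub hy)))
      (fun y hy => by
        rw [← NNReal.coe_le_coe, coe_nnnorm, Real.coe_toNNReal _ hK0]; exact hK y hy)
  set G : ℝ → ℝ := fun y => deriv V (projIcc p q hpq y) with hGdef
  have hG : LipschitzWith K.toNNReal G := by
    have := (LipschitzOnWith.to_restrict hLip).comp (LipschitzWith.projIcc hpq)
    rw [mul_one] at this
    exact this
  have hGle : ∀ y, |G y| ≤ C := fun y => hC _ (projIcc p q hpq y).2
  have hGeq : ∀ y ∈ Icc p q, G y = deriv V y := fun y hy => by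
    simp only [hGdef, projIcc_of_mem hpq hy]
  set F : ℝ → ℝ → ℝ := fun t x => -(1 / ε) * (G x - G (2 * a * (1 + t) - x)) with hF
  -- The radius is the speed bound times the length of the interval, so one application covers all
  -- of it.
  have hPL : IsPicardLindelof F (⟨0, le_rfl, hT⟩ : Icc (0 : ℝ) (endTime a b)) a
      ((1 / ε * (2 * C)) * endTime a b).toNNReal 0 (1 / ε * (2 * C)).toNNReal
      (1 / ε * (2 * K)).toNNReal := by
    refine ⟨fun t _ => ?_, fun x _ => ?_, fun t _ x _ => ?_, ?_⟩
    · refine (LipschitzWith.of_dist_le_mul fun x y => ?_).lipschitzOnWith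
      rw [Real.coe_toNNReal _ (by positivity), Real.dist_eq, Real.dist_eq]
      have h1 := hG.dist_le_mul x y
      have h2 := hG.dist_le_mul (2 * a * (1 + t) - x) (2 * a * (1 + t) - y)
      rw [Real.coe_toNNReal _ hK0, Real.dist_eq, Real.dist_eq] at h1 h2
      rw [show 2 * a * (1 + t) - x - (2 * a * (1 + t) - y) = -(x - y) by ring, abs_neg] at h2
      have : F t x - F t y = -(1 / ε) * ((G x - G y)
          - (G (2 * a * (1 + t) - x) - G (2 * a * (1 + t) - y))) := by
        simp only [hF]; ring
      rw [this, abs_mul, abs_neg, abs_of_pos hεinv, mul_assoc (1 / ε)]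
      refine mul_le_mul_of_nonneg_left ((abs_sub _ _).trans ?_) hεinv.le
      linarith
    · have := hG.continuous
      exact Continuous.continuousOn (by simp only [hF]; fun_prop)
    · rw [Real.coe_toNNReal _ (by positivity), Real.norm_eq_abs]
      simp only [hF]
      rw [abs_mul, abs_neg, abs_of_pos hεinv]
      refine mul_le_mul_of_nonneg_left ((abs_sub _ _).trans ?_) hεinv.le
      linarith [hGle x, hGle (2 * a * (1 + t) - x)]
    · rw [Real.coe_toNNReal _ (by positivity), Real.coe_toNNReal _ (by positivity)]
      simp [hT]
  obtain ⟨x, hx0, hode⟩ := hPL.exists_eq_forall_mem_Icc_hasDerivWithinAt₀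
  have htube := mem_tube_of_hasDerivWithinAt (G := G) (p := p) (q := q) hapos hu hε
    (by rw [hp]; linarith) le_rfl (fun y hy z hz hyz => by
      rw [hGeq y hy, hGeq z hz]
      exact hV.mul_sub_le ha₀ (by have := hy.1; rw [hp] at this; linarith) hyz) hx0 hode
  have hmem : ∀ t ∈ Icc 0 (endTime a b), x t ∈ Ioo 0 (2 * a * (1 + t)) := fun t ht => by
    have h1 := htube t ht
    have h2 := mul_nonneg hapos.le ht.1
    constructor <;> linarith
  refine ⟨x, hx0, hmem, fun t ht => ?_⟩
  have h1 := htube t ht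
  have h2 := mul_nonneg hapos.le ht.1
  have h3 := mul_one_add_le_of_le_endTime hapos ht.2
  rw [hV.deriv_energy (hmem t ht).1 (hmem t ht).2, ← hGeq, ← hGeq]
  · exact hode t ht
  · rw [hp, hq]; constructor <;> linarith
  · rw [hp, hq]; constructor <;> linarith

/-- The deterministic path is close to the midpoint, and the linearised drift along it is
continuous and bounded, uniformly in small `ε`. -/
lemma exists_detPath_bounds (hU : IsPairPotential U a b a₀ u₀)
    (hV : IsConvexExtension V U b a₀ u₀) :
    ∃ c > 0, ∃ C > 0, ∃ ε₀ > 0, ∀ ε, 0 < ε → ε < ε₀ →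
      ContinuousOn (detPath V a b ε) (Icc 0 (endTime a b)) ∧
      (∀ t ∈ Icc 0 (endTime a b), a * (1 + t) - c * ε ≤ detPath V a b ε t ∧
        detPath V a b ε t ≤ a * (1 + t)) ∧
      ContinuousOn (drift V a b ε) (Icc 0 (endTime a b)) ∧
      ∀ t ∈ Icc 0 (endTime a b), |drift V a b ε t| ≤ C := by
  have ha₀ := hU.a₀_pos
  have ha := hU.a₀_lt
  have hab := hU.a_lt_b
  have hu := hU.u₀_pos
  have hapos : 0 < a := ha₀.trans ha
  set p := (a + a₀) / 2 with hp
  have hppos : 0 < p := by rw [hp]; linarith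
  obtain ⟨C, hC⟩ := isCompact_Icc.exists_bound_of_continuousOn
    (hV.continuousOn_deriv_deriv.mono
      (fun y hy => lt_of_lt_of_le hppos hy.1 : Icc p (2 * b) ⊆ Ioi 0))
  refine ⟨a / u₀, by positivity, 2 * |C| + 1, by positivity, (a - a₀) / 2 / (a / u₀),
    div_pos (by linarith) (by positivity), fun ε hε hεlt => ?_⟩
  rw [lt_div_iff₀ (by positivity)] at hεlt
  have hεa : a / u₀ * ε ≤ (a - a₀) / 2 := by linarith
  have hex := hV.exists_isDetSolution ha₀ ha hab hu hε hεa
  -- The tube estimate holds for every solution, so it does not matter which one was chosen.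
  have hsol : IsDetSolution V a b ε (detPath V a b ε) := by
    rw [detPath, dif_pos hex]; exact hex.choose_spec
  have htube := hsol.mem_tube hV ha₀ ha hu hε hεa
  have hcont : ContinuousOn (detPath V a b ε) (Icc 0 (endTime a b)) :=
    fun t ht => (hsol.ode t ht).continuousWithinAt
  have hargs : ∀ t ∈ Icc 0 (endTime a b), detPath V a b ε t ∈ Icc p (2 * b) ∧
      2 * a * (1 + t) - detPath V a b ε t ∈ Icc p (2 * b) := fun t ht => by
    have h1 := htube t ht
    have h2 := mul_nonneg hapos.le ht.1
    have h3 := mul_one_add_le_of_le_endTime hapos ht.2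
    rw [hp]
    refine ⟨⟨?_, ?_⟩, ?_, ?_⟩ <;> linarith
  have hsub : ∀ y ∈ Icc p (2 * b), y ∈ Ioi (0 : ℝ) := fun y hy => lt_of_lt_of_le hppos hy.1
  refine ⟨hcont, htube, ?_, fun t ht => ?_⟩
  · refine ContinuousOn.sub (ContinuousOn.neg ?_) ?_
    · exact hV.continuousOn_deriv_deriv.comp hcont fun t ht => hsub _ (hargs t ht).1
    · exact hV.continuousOn_deriv_deriv.comp (ContinuousOn.sub (by fun_prop) hcont)
        fun t ht => hsub _ (hargs t ht).2
  · have h1 := hC _ (hargs t ht).1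
    have h2 := hC _ (hargs t ht).2
    rw [Real.norm_eq_abs] at h1 h2
    have h3 := le_abs_self C
    rw [drift]
    refine (abs_sub _ _).trans ?_
    rw [abs_neg]
    linarith

end Potential

/-! ### Kolmogorov's maximal inequality -/

section Kolmogorov

variable {Ω : Type*} [MeasurableSpace Ω] {P : Measure Ω} [IsProbabilityMeasure P]

lemma integral_sq_sum_of_iIndepFun {ξ : ℕ → Ω → ℝ} (hind : iIndepFun ξ P)
    (hL2 : ∀ i, MemLp (ξ i) 2 P) (hmean : ∀ i, ∫ ω, ξ i ω ∂P = 0) (n : ℕ) :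
    ∫ ω, (∑ i ∈ Finset.range n, ξ i ω) ^ 2 ∂P = ∑ i ∈ Finset.range n, ∫ ω, ξ i ω ^ 2 ∂P := by
  have h0 : ∫ ω, (∑ i ∈ Finset.range n, ξ i) ω ∂P = 0 := by
    simp only [Finset.sum_apply]
    rw [integral_finsetSum _ fun i _ => (hL2 i).integrable (by norm_num)]
    simp [hmean]
  have hm : MemLp (∑ i ∈ Finset.range n, ξ i) 2 P := memLp_finsetSum' _ fun i _ => hL2 i
  have hv := IndepFun.variance_sum (s := Finset.range n) (fun i _ => hL2 i)
    fun i _ j _ hij => hind.indepFun hij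
  rw [variance_of_integral_eq_zero hm.aemeasurable h0] at hv
  simp only [Finset.sum_apply] at hv
  rw [hv]
  exact Finset.sum_congr rfl fun i _ =>
    variance_of_integral_eq_zero (hL2 i).aemeasurable (hmean i)

/-- The squares of the partial sums of independent centred variables form a submartingale. -/
lemma submartingale_sq_sum {ξ : ℕ → Ω → ℝ} (hmeas : ∀ i, StronglyMeasurable (ξ i))
    (hind : iIndepFun ξ P) (hL2 : ∀ i, MemLp (ξ i) 2 P) (hmean : ∀ i, ∫ ω, ξ i ω ∂P = 0) :
    Submartingale (fun n ω => (∑ i ∈ Finset.range (n + 1), ξ i ω) ^ 2)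
      (Filtration.natural ξ hmeas) P := by
  have hadp : ∀ n, StronglyMeasurable[Filtration.natural ξ hmeas n]
      (fun ω => ∑ i ∈ Finset.range (n + 1), ξ i ω) := fun n =>
    Finset.stronglyMeasurable_fun_sum _ fun i hi =>
      (Filtration.stronglyAdapted_natural hmeas i).mono
        ((Filtration.natural ξ hmeas).mono (Nat.lt_succ_iff.1 (Finset.mem_range.1 hi)))
  have hm : ∀ n, MemLp (fun ω => ∑ i ∈ Finset.range (n + 1), ξ i ω) 2 P := fun n =>
    memLp_finsetSum _ fun i _ => hL2 i
  refine submartingale_of_setIntegral_le_succ (fun n => (hadp n).pow 2)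
    (fun n => (hm n).integrable_sq) fun n A hA => ?_
  have hA' : MeasurableSet A := (Filtration.natural ξ hmeas).le n A hA
  set S : Ω → ℝ := fun ω => ∑ i ∈ Finset.range (n + 1), ξ i ω with hS
  have hSξ : Integrable (fun ω => S ω * ξ (n + 1) ω) P := (hm n).integrable_mul (hL2 (n + 1))
  -- `1_A S` depends on the variables up to index `n` only, hence is independent of the centred `ξ
  -- (n + 1)`.
  have hcross : ∫ ω in A, S ω * ξ (n + 1) ω ∂P = 0 := by
    rw [← integral_indicator hA']
    have hI : IndepFun (A.indicator S) (ξ (n + 1)) P := by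
      have := (hind.indep_comap_natural_of_lt hmeas (Nat.lt_succ_self n)).symm
      rw [IndepFun_iff_Indep]
      refine indep_of_indep_of_le_left this ?_
      exact ((hadp n).indicator hA).measurable.comap_le
    have heq : (A.indicator fun ω => S ω * ξ (n + 1) ω) = A.indicator S * ξ (n + 1) := by
      ext ω; by_cases h : ω ∈ A <;> simp [h]
    rw [heq, hI.integral_mul_eq_mul_integral
      ((hm n).indicator hA').aestronglyMeasurable (hL2 _).aestronglyMeasurable, hmean, mul_zero]
  have hexp : ∀ ω, (∑ i ∈ Finset.range (n + 1 + 1), ξ i ω) ^ 2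
      = S ω ^ 2 + 2 * (S ω * ξ (n + 1) ω) + ξ (n + 1) ω ^ 2 := fun ω => by
    rw [Finset.sum_range_succ]; simp only [hS]; ring
  have i1 : Integrable (fun ω => S ω ^ 2) (P.restrict A) := (hm n).integrable_sq.integrableOn
  have i2 : Integrable (fun ω => 2 * (S ω * ξ (n + 1) ω)) (P.restrict A) :=
    (hSξ.const_mul 2).integrableOn
  have i3 : Integrable (fun ω => ξ (n + 1) ω ^ 2) (P.restrict A) :=
    (hL2 (n + 1)).integrable_sq.integrableOn
  have i12 : Integrable (fun ω => S ω ^ 2 + 2 * (S ω * ξ (n + 1) ω)) (P.restrict A) := i1.add i2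
  simp only [hexp]
  rw [integral_add i12 i3, integral_add i1 i2, integral_const_mul, hcross]
  have : 0 ≤ ∫ ω in A, ξ (n + 1) ω ^ 2 ∂P := integral_nonneg fun _ => sq_nonneg _
  linarith

/-- **Kolmogorov's maximal inequality**. -/
lemma measure_exists_le_abs_sum_le {ξ : ℕ → Ω → ℝ} (hmeas : ∀ i, Measurable (ξ i))
    (hind : iIndepFun ξ P) (hL2 : ∀ i, MemLp (ξ i) 2 P) (hmean : ∀ i, ∫ ω, ξ i ω ∂P = 0)
    {r v : ℝ} (hr : 0 < r) (n : ℕ)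
    (hv : ∑ i ∈ Finset.range n, ∫ ω, ξ i ω ^ 2 ∂P ≤ v) :
    P {ω | ∃ k ≤ n, r ≤ |∑ i ∈ Finset.range k, ξ i ω|} ≤ ENNReal.ofReal (v / r ^ 2) := by
  -- The submartingale starts at the sum of one term; the empty sum is `0` and never reaches `r >
  -- 0`.
  rcases n with _ | n
  · have : {ω | ∃ k ≤ 0, r ≤ |∑ i ∈ Finset.range k, ξ i ω|} = ∅ := by
      ext ω; simp [hr]
    rw [this]; simp
  have hsub := submartingale_sq_sum (fun i => (hmeas i).stronglyMeasurable) hind hL2 hmean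
  have hmax := maximal_ineq hsub (fun n ω => sq_nonneg _) (ε := (r ^ 2).toNNReal) n
  have hr2 : ((r ^ 2).toNNReal : ℝ) = r ^ 2 := Real.coe_toNNReal _ (sq_nonneg r)
  have hsubset : {ω | ∃ k ≤ n + 1, r ≤ |∑ i ∈ Finset.range k, ξ i ω|} ⊆
      {ω | ((r ^ 2).toNNReal : ℝ) ≤ (Finset.range (n + 1)).sup' Finset.nonempty_range_add_one
        fun k => (∑ i ∈ Finset.range (k + 1), ξ i ω) ^ 2} := by
    rintro ω ⟨k, hk, hrk⟩
    rcases k with _ | k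
    · simp at hrk; linarith
    · simp only [Set.mem_ofPred_eq, hr2]
      refine le_trans ?_ (Finset.le_sup' (fun k => (∑ i ∈ Finset.range (k + 1), ξ i ω) ^ 2)
        (Finset.mem_range.2 (by omega : k < n + 1)))
      rw [← sq_abs (∑ i ∈ Finset.range (k + 1), ξ i ω)]
      gcongr
  have hint : Integrable (fun ω => (∑ i ∈ Finset.range (n + 1), ξ i ω) ^ 2) P := hsub.integrable n
  have hle := (hmax.trans (ENNReal.ofReal_le_ofReal
    ((setIntegral_le_integral hint (ae_of_all _ fun ω => sq_nonneg _)).trans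
      ((integral_sq_sum_of_iIndepFun hind hL2 hmean (n + 1)).le.trans hv))))
  refine (measure_mono hsubset).trans ?_
  rw [ENNReal.ofReal_div_of_pos (by positivity), ENNReal.le_div_iff_mul_le
    (Or.inl (by simpa using hr.ne')) (Or.inl ENNReal.ofReal_ne_top), mul_comm]
  exact hle

end Kolmogorov

/-! ### Weighted sums of Brownian increments -/

section Increments

variable {Ω : Type*} [MeasurableSpace Ω] {P : Measure Ω} {W : ℝ≥0 → Ω → ℝ}

lemma monotone_grid {s h : ℝ} (hh : 0 ≤ h) : Monotone fun k : ℕ => (s + k * h).toNNReal :=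
  fun i j hij => Real.toNNReal_le_toNNReal (by gcongr)

lemma iIndepFun_weighted_increments (hW : IsPreBrownianReal W P) {s h : ℝ} (hh : 0 ≤ h)
    (c : ℕ → ℝ) :
    iIndepFun (fun (k : ℕ) ω => c k * (W (s + (k + 1) * h).toNNReal ω
      - W (s + k * h).toNNReal ω)) P := by
  have := (hW.hasIndepIncrements.nat (monotone_grid (s := s) hh)).comp (fun k x => c k * x)
    (fun k => by fun_prop)
  simpa [Function.comp_def] using this

lemma memLp_increment (hW : IsPreBrownianReal W P) (s t : ℝ≥0) :
    MemLp (fun ω => W t ω - W s ω) 2 P :=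
  (hW.hasLaw_sub t s).hasGaussianLaw.memLp_two

lemma integral_increment (hW : IsPreBrownianReal W P) (s t : ℝ≥0) :
    ∫ ω, W t ω - W s ω ∂P = 0 := by
  have := (hW.hasLaw_sub t s).integral_eq
  rwa [integral_id_gaussianReal] at this

lemma integral_sq_increment (hW : IsPreBrownianReal W P) (s t : ℝ≥0) :
    ∫ ω, (W t ω - W s ω) ^ 2 ∂P = |(t : ℝ) - s| := by
  have := (hW.hasLaw_sub t s).variance_eq
  rw [variance_id_gaussianReal] at this
  rw [← variance_of_integral_eq_zero (memLp_increment hW s t).aemeasurable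
    (integral_increment hW s t)]
  exact this

lemma integral_sq_weighted_increment (hW : IsPreBrownianReal W P) {s h : ℝ} (hs : 0 ≤ s)
    (hh : 0 ≤ h) (c : ℝ) (k : ℕ) :
    ∫ ω, (c * (W (s + (k + 1) * h).toNNReal ω - W (s + k * h).toNNReal ω)) ^ 2 ∂P
      = c ^ 2 * h := by
  simp only [mul_pow]
  rw [integral_const_mul, integral_sq_increment hW, Real.coe_toNNReal _ (by positivity),
    Real.coe_toNNReal _ (by positivity)]
  congr 1
  rw [show s + (k + 1) * h - (s + k * h) = h by ring, abs_of_nonneg hh]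

lemma measure_exists_le_abs_weighted_sum_le [IsProbabilityMeasure P] (hW : IsPreBrownianReal W P)
    (hWm : ∀ t, Measurable (W t))
    {s h r M : ℝ} (hs : 0 ≤ s) (hh : 0 ≤ h) (hr : 0 < r) (c : ℕ → ℝ) (n : ℕ)
    (hc : ∀ k < n, |c k| ≤ M) :
    P {ω | ∃ k ≤ n, r ≤ |∑ i ∈ Finset.range k, c i * (W (s + (i + 1) * h).toNNReal ω
      - W (s + i * h).toNNReal ω)|} ≤ ENNReal.ofReal (M ^ 2 * (n * h) / r ^ 2) := by
  refine measure_exists_le_abs_sum_le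
    (ξ := fun (k : ℕ) ω => c k * (W (s + (k + 1) * h).toNNReal ω - W (s + k * h).toNNReal ω))
    (fun i => ?_) (iIndepFun_weighted_increments hW hh c) (fun i => ?_) (fun i => ?_) hr n ?_
  · exact ((hWm _).sub (hWm _)).const_mul _
  · exact (memLp_increment hW _ _).const_mul _
  · rw [integral_const_mul, integral_increment hW, mul_zero]
  · simp only [integral_sq_weighted_increment hW hs hh]
    calc ∑ i ∈ Finset.range n, c i ^ 2 * h ≤ ∑ i ∈ Finset.range n, M ^ 2 * h := by
          refine Finset.sum_le_sum fun i hi => mul_le_mul_of_nonneg_right ?_ hh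
          rw [← sq_abs]
          exact pow_le_pow_left₀ (abs_nonneg _) (hc i (Finset.mem_range.1 hi)) 2
      _ = M ^ 2 * (n * h) := by simp; ring

end Increments

/-! ### Wiener integrals as limits of Riemann sums -/

section WienerIntegral

variable {Ω : Type*} [MeasurableSpace Ω] {P : Measure Ω} {W W' : ℝ≥0 → Ω → ℝ} {g g' : ℝ → ℝ}
  {s t : ℝ} {Z : Ω → ℝ}

lemma aemeasurable_wienerSum (hW : ∀ t, AEMeasurable (W t) P) (g : ℝ → ℝ) (s t : ℝ) (n : ℕ) :
    AEMeasurable (wienerSum W g s t n) P := by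
  unfold wienerSum
  exact Finset.aemeasurable_fun_sum _ fun k _ => ((hW _).sub (hW _)).const_mul _

/-- Serves to replace Brownian motion by a version measurable at each time, as the natural
filtration requires. -/
lemma IsWienerIntegral.congr_process (h : IsWienerIntegral W P g s t Z)
    (hW : ∀ t, W t =ᵐ[P] W' t) : IsWienerIntegral W' P g s t Z := by
  refine ⟨h.1, h.2.congr fun n => eLpNorm_congr_ae ?_⟩
  have h1 : ∀ᵐ ω ∂P, ∀ k : ℕ,
      W (s + k * ((t - s) / n)).toNNReal ω = W' (s + k * ((t - s) / n)).toNNReal ω :=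
    ae_all_iff.2 fun k => hW _
  have h2 : ∀ᵐ ω ∂P, ∀ k : ℕ,
      W (s + (k + 1) * ((t - s) / n)).toNNReal ω = W' (s + (k + 1) * ((t - s) / n)).toNNReal ω :=
    ae_all_iff.2 fun k => hW _
  filter_upwards [h1, h2] with ω e1 e2
  simp only [Pi.sub_apply, wienerSum, e1, e2]

lemma wienerGrid_mem_Icc (hst : s ≤ t) {k n : ℕ} (hk : k ≤ n) :
    s + k * ((t - s) / n) ∈ Icc s t := by
  rcases Nat.eq_zero_or_pos n with rfl | hn
  · obtain rfl : k = 0 := by omega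
    simpa using hst
  have hn' : (0 : ℝ) < n := Nat.cast_pos.2 hn
  have hk' : (k : ℝ) ≤ n := Nat.cast_le.2 hk
  constructor
  · have : 0 ≤ (k : ℝ) * ((t - s) / n) := by
      have := sub_nonneg.2 hst
      positivity
    linarith
  · have : (k : ℝ) * ((t - s) / n) ≤ n * ((t - s) / n) :=
      mul_le_mul_of_nonneg_right hk' (div_nonneg (sub_nonneg.2 hst) hn'.le)
    rw [mul_div_cancel₀ _ hn'.ne'] at this
    linarith

lemma IsWienerIntegral.const_mul (h : IsWienerIntegral W P g s t Z) (hst : s ≤ t) (c : ℝ)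
    (hg : ∀ u ∈ Icc s t, g' u = c * g u) :
    IsWienerIntegral W P g' s t (fun ω => c * Z ω) := by
  refine ⟨h.1.const_mul c, ?_⟩
  have heq : ∀ n, wienerSum W g' s t n - (fun ω => c * Z ω)
      = c • (wienerSum W g s t n - Z) := fun n => by
    ext ω
    simp only [Pi.sub_apply, Pi.smul_apply, smul_eq_mul, wienerSum, mul_sub c _ (Z ω),
      Finset.mul_sum]
    congr 1
    refine Finset.sum_congr rfl fun k hk => ?_
    rw [hg _ (wienerGrid_mem_Icc hst (Finset.mem_range.1 hk).le)]
    ring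
  simp only [heq, eLpNorm_const_smul]
  simpa using ENNReal.Tendsto.const_mul h.2 (Or.inr (by simp : ‖c‖ₑ ≠ ∞))

lemma IsWienerIntegral.tendsto_measure (h : IsWienerIntegral W P g s t Z)
    (hW : ∀ t, AEMeasurable (W t) P) {r : ℝ} (hr : 0 < r) :
    Tendsto (fun n => P {ω | r ≤ |wienerSum W g s t n ω - Z ω|}) atTop (𝓝 0) := by
  have := tendstoInMeasure_of_tendsto_eLpNorm_of_ne_top (by norm_num) (by norm_num)
    (fun n => (aemeasurable_wienerSum hW g s t n).aestronglyMeasurable)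
    h.1.aestronglyMeasurable h.2
  simpa only [Real.norm_eq_abs] using tendstoInMeasure_iff_norm.1 this r hr

/-- The Wiener integral of a function close to `1` is close to the Brownian increment. -/
lemma IsWienerIntegral.measure_le_abs_sub_increment [IsProbabilityMeasure P]
    (hW : IsPreBrownianReal W P) (hWm : ∀ t, Measurable (W t)) (h : IsWienerIntegral W P g s t Z)
    (hs : 0 ≤ s) (hst : s ≤ t) {η r : ℝ} (hg : ∀ u ∈ Icc s t, |g u - 1| ≤ η) (hr : 0 < r) :
    P {ω | r ≤ |Z ω - (W t.toNNReal ω - W s.toNNReal ω)|}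
      ≤ ENNReal.ofReal (4 * (η ^ 2 * (t - s)) / r ^ 2) := by
  -- Half of `r` is reserved for the Riemann sum error, whose probability vanishes as `n → ∞`; the
  -- other half produces the factor `4`.
  have hlim := (h.tendsto_measure (fun t => (hWm t).aemeasurable) (half_pos hr)).const_add
    (ENNReal.ofReal (4 * (η ^ 2 * (t - s)) / r ^ 2))
  rw [add_zero] at hlim
  refine ge_of_tendsto hlim ?_
  filter_upwards [eventually_gt_atTop 0] with n hn
  have hn' : (0 : ℝ) < n := Nat.cast_pos.2 hn
  have hstep : 0 ≤ (t - s) / n := div_nonneg (sub_nonneg.2 hst) hn'.le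
  have hmax := measure_exists_le_abs_weighted_sum_le hW hWm hs hstep (half_pos hr)
    (fun k => g (s + k * ((t - s) / n)) - 1) n
    (fun k hk => hg _ (wienerGrid_mem_Icc hst hk.le))
  rw [mul_div_cancel₀ _ hn'.ne', show η ^ 2 * (t - s) / (r / 2) ^ 2
    = 4 * (η ^ 2 * (t - s)) / r ^ 2 by field_simp; ring] at hmax
  refine (measure_mono ?_).trans ((measure_union_le _ _).trans (add_le_add hmax le_rfl))
  intro ω hω
  by_contra hcon
  simp only [mem_union, Set.mem_ofPred_eq, not_or, not_exists, not_and, not_le] at hcon hω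
  have h1 := hcon.1 n le_rfl
  -- Weights `1` telescope to the Brownian increment, so weights `g - 1` give the difference to be
  -- bounded.
  have htel : ∑ i ∈ Finset.range n, (g (s + i * ((t - s) / n)) - 1) *
      (W (s + (i + 1) * ((t - s) / n)).toNNReal ω - W (s + i * ((t - s) / n)).toNNReal ω)
      = wienerSum W g s t n ω - (W t.toNNReal ω - W s.toNNReal ω) := by
    have := Finset.sum_range_sub (fun i : ℕ => W (s + i * ((t - s) / n)).toNNReal ω) n
    simp only [mul_div_cancel₀ _ hn'.ne', Nat.cast_zero, zero_mul, add_zero, Nat.cast_add,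
      Nat.cast_one, add_sub_cancel] at this
    rw [wienerSum, ← this, ← Finset.sum_sub_distrib]
    exact Finset.sum_congr rfl fun i _ => by ring
  rw [htel] at h1
  have h2 := hcon.2
  rw [abs_lt] at h1 h2
  refine absurd hω (not_le.2 (abs_lt.2 ⟨?_, ?_⟩)) <;> linarith [h1.1, h1.2, h2.1, h2.2]

variable {Z : ℝ → Ω → ℝ}

/-- With `j * l` steps for the `j`-th grid point, all Riemann sums have the common mesh `d/(ml)` and
are partial sums of one sequence, so a single maximal inequality controls them. Letting `l → ∞`
removes the errors at the `m` points. -/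
lemma measure_exists_le_abs_wienerIntegral_grid [IsProbabilityMeasure P]
    (hW : IsPreBrownianReal W P) (hWm : ∀ t, Measurable (W t)) {d M r : ℝ} (hs : 0 ≤ s)
    (hd : 0 < d) (hg : ∀ u ∈ Icc s (s + d), |g u| ≤ M)
    (hZ : ∀ t ∈ Icc s (s + d), IsWienerIntegral W P g s t (Z t)) (hr : 0 < r) {m : ℕ}
    (hm : 0 < m) :
    P {ω | ∃ j : ℕ, 1 ≤ j ∧ j ≤ m ∧ r ≤ |Z (s + j * (d / m)) ω|}
      ≤ ENNReal.ofReal (4 * (M ^ 2 * d) / r ^ 2) := by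
  have hm' : (0 : ℝ) < m := Nat.cast_pos.2 hm
  have hmem : ∀ j ≤ m, s + (j : ℝ) * (d / m) ∈ Icc s (s + d) := fun j hj => by
    simpa using wienerGrid_mem_Icc (s := s) (t := s + d) (by linarith) hj
  have hlim : Tendsto (fun l : ℕ => ENNReal.ofReal (4 * (M ^ 2 * d) / r ^ 2) +
      ∑ j ∈ Finset.Icc 1 m, P {ω | r / 2 ≤ |wienerSum W g s (s + j * (d / m)) (j * l) ω
        - Z (s + j * (d / m)) ω|}) atTop
      (𝓝 (ENNReal.ofReal (4 * (M ^ 2 * d) / r ^ 2) + ∑ j ∈ Finset.Icc 1 m, 0)) := by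
    refine (tendsto_finsetSum _ fun j hj => ?_).const_add _
    rw [Finset.mem_Icc] at hj
    exact ((hZ _ (hmem j hj.2)).tendsto_measure (fun t => (hWm t).aemeasurable)
      (half_pos hr)).comp (tendsto_id.const_mul_atTop' (by omega))
  rw [Finset.sum_const_zero, add_zero] at hlim
  refine ge_of_tendsto hlim ?_
  filter_upwards [eventually_gt_atTop 0] with l hl
  have hl' : (0 : ℝ) < l := Nat.cast_pos.2 hl
  have hstep : 0 ≤ d / (m * l : ℕ) := by positivity
  have hmax := measure_exists_le_abs_weighted_sum_le hW hWm hs hstep (half_pos hr)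
    (fun k => g (s + k * (d / (m * l : ℕ)))) (m * l)
    (fun k hk => hg _ (by simpa using wienerGrid_mem_Icc (s := s) (t := s + d) (by linarith) hk.le))
  rw [mul_div_cancel₀ _ (by positivity), show M ^ 2 * d / (r / 2) ^ 2
    = 4 * (M ^ 2 * d) / r ^ 2 by field_simp; ring] at hmax
  refine (measure_mono ?_).trans ((measure_union_le _ (⋃ j ∈ Finset.Icc 1 m,
    {ω | r / 2 ≤ |wienerSum W g s (s + j * (d / m)) (j * l) ω
        - Z (s + j * (d / m)) ω|})).trans (add_le_add hmax (measure_biUnion_finset_le _ _)))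
  rintro ω ⟨j, hj1, hjm, hjr⟩
  by_contra hcon
  simp only [mem_union, Set.mem_ofPred_eq, not_or, not_exists, not_and, not_le, mem_iUnion,
    Finset.mem_Icc] at hcon
  have h1 := hcon.1 (j * l) (Nat.mul_le_mul_right l hjm)
  have h2 := hcon.2 j ⟨hj1, hjm⟩
  have hj' : (0 : ℝ) < j := Nat.cast_pos.2 hj1
  have hsum : wienerSum W g s (s + j * (d / m)) (j * l) ω
      = ∑ i ∈ Finset.range (j * l), g (s + i * (d / (m * l : ℕ))) *
        (W (s + (i + 1) * (d / (m * l : ℕ))).toNNReal ω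
          - W (s + i * (d / (m * l : ℕ))).toNNReal ω) := by
    have : (s + (j : ℝ) * (d / m) - s) / (j * l : ℕ) = d / (m * l : ℕ) := by
      push_cast; field_simp; ring
    rw [wienerSum, this]
  rw [hsum] at h2
  rw [abs_lt] at h1 h2
  refine absurd hjr (not_le.2 (abs_lt.2 ⟨?_, ?_⟩)) <;> linarith [h1.1, h1.2, h2.1, h2.2]

/-- A maximal inequality for Wiener integrals along the dyadic points of `(s, s + d]`. -/
lemma measure_exists_le_abs_wienerIntegral_dyadic [IsProbabilityMeasure P]
    (hW : IsPreBrownianReal W P) (hWm : ∀ t, Measurable (W t)) {d M r : ℝ} (hs : 0 ≤ s)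
    (hd : 0 < d) (hg : ∀ u ∈ Icc s (s + d), |g u| ≤ M)
    (hZ : ∀ t ∈ Icc s (s + d), IsWienerIntegral W P g s t (Z t)) (hr : 0 < r) :
    P {ω | ∃ p j : ℕ, 1 ≤ j ∧ j ≤ 2 ^ p ∧ r ≤ |Z (s + j * (d / (2 ^ p : ℕ))) ω|}
      ≤ ENNReal.ofReal (4 * (M ^ 2 * d) / r ^ 2) := by
  have hunion : {ω | ∃ p j : ℕ, 1 ≤ j ∧ j ≤ 2 ^ p ∧ r ≤ |Z (s + j * (d / (2 ^ p : ℕ))) ω|}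
      = ⋃ p : ℕ, {ω | ∃ j : ℕ, 1 ≤ j ∧ j ≤ 2 ^ p ∧ r ≤ |Z (s + j * (d / (2 ^ p : ℕ))) ω|} := by
    ext ω; simp
  -- The grids are nested and the bound does not depend on `p`, so continuity from below applies.
  rw [hunion, Directed.measure_iUnion]
  · exact iSup_le fun p => measure_exists_le_abs_wienerIntegral_grid hW hWm hs hd hg hZ hr
      (by positivity)
  · refine (monotone_nat_of_le_succ fun p => ?_).directed_le
    rintro ω ⟨j, hj1, hjp, hjr⟩
    refine ⟨j * 2, by omega, by rw [pow_succ]; omega, ?_⟩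
    rwa [show ((j * 2 : ℕ) : ℝ) * (d / (2 ^ (p + 1) : ℕ)) = j * (d / (2 ^ p : ℕ)) by
      push_cast; field_simp; ring]

end WienerIntegral

/-! ### Brownian motion rises quickly -/

section SmallBall

variable {Ω : Type*} [MeasurableSpace Ω] {P : Measure Ω} {W : ℝ≥0 → Ω → ℝ}

lemma gaussianReal_Iio_lt_one (x : ℝ) : gaussianReal 0 1 (Iio x) < 1 := by
  have hpos : 0 < gaussianReal 0 1 (Iio x)ᶜ := by
    rw [pos_iff_ne_zero]
    intro h
    have := gaussianReal_absolutelyContinuous' 0 (one_ne_zero : (1 : ℝ≥0) ≠ 0) h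
    rw [compl_Iio, Real.volume_Ici] at this
    exact ENNReal.top_ne_zero this
  rw [prob_compl_eq_one_sub measurableSet_Iio] at hpos
  exact tsub_pos_iff_lt.1 hpos

lemma gaussianReal_Iio_le {c x y : ℝ} {v : ℝ≥0} (hc : 0 < c) (hv : (v : ℝ) = c ^ 2)
    (hxy : x ≤ c * y) : gaussianReal 0 v (Iio x) ≤ gaussianReal 0 1 (Iio y) := by
  have hmap := gaussianReal_map_const_mul (μ := 0) (v := 1) c
  have hv' : (.mk (c ^ 2) (sq_nonneg _) * 1 : ℝ≥0) = v := by
    ext; simp [hv]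
  rw [mul_zero, hv'] at hmap
  rw [← hmap, Measure.map_apply (by fun_prop) measurableSet_Iio]
  refine measure_mono fun z hz => ?_
  rw [mem_preimage, mem_Iio] at hz
  exact lt_of_mul_lt_mul_left (hz.trans_le hxy) hc.le

lemma measure_le_abs_increment_le [IsProbabilityMeasure P] (hW : IsPreBrownianReal W P)
    (s t : ℝ≥0) {r : ℝ} (hr : 0 < r) :
    P {ω | r ≤ |W t ω - W s ω|} ≤ ENNReal.ofReal (|(t : ℝ) - s| / r ^ 2) := by
  have := meas_ge_le_variance_div_sq (memLp_increment hW s t) hr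
  rw [integral_increment hW s t, variance_of_integral_eq_zero
    (memLp_increment hW s t).aemeasurable (integral_increment hW s t),
    integral_sq_increment hW s t] at this
  simpa using this

/-- Immediately after any time, Brownian motion takes positive values of the natural size with
probability close to one, uniformly in the starting time and the scale `w`. -/
lemma exists_measure_forall_increment_lt_le [IsProbabilityMeasure P] (hW : IsPreBrownianReal W P)
    {θ : ℝ} (hθ : 0 < θ) :
    ∃ (K : ℕ) (ρ : ℝ), 0 < ρ ∧ ρ < 1 ∧ ∀ s w : ℝ, 0 ≤ s → 0 < w →
      P {ω | ∀ i < K, W (s + (w * ρ ^ i) ^ 2).toNNReal ω - W s.toNNReal ω < w * ρ ^ K}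
        ≤ ENNReal.ofReal θ := by
  -- An attempt must gain `2v` with standard deviation at least `v/2`; this is the `4`. `K` makes `q
  -- ^ K` small before `ρ` is chosen.
  set q := gaussianReal 0 1 (Iio (4 : ℝ)) with hq
  obtain ⟨K, hK⟩ := ((ENNReal.tendsto_pow_atTop_nhds_zero_of_lt_one
    (gaussianReal_Iio_lt_one 4)).eventually
      (Iio_mem_nhds (ENNReal.ofReal_pos.2 (half_pos hθ)))).exists
  -- The bound `1/2` keeps the standard deviations large; the other makes the sum of `K` Chebyshev
  -- bounds `ρ²` at most `θ/2`.
  set ρ := min (1 / 2) (θ / (2 * (K + 1))) with hρ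
  have hρ0 : 0 < ρ := lt_min (by norm_num) (by positivity)
  have hρ1 : ρ ≤ 1 / 2 := min_le_left _ _
  have hρK : K * ρ ^ 2 ≤ θ / 2 := by
    have h1 : ρ ^ 2 ≤ ρ := by nlinarith
    have h2 : ρ ≤ θ / (2 * (K + 1)) := min_le_right _ _
    rw [le_div_iff₀ (by positivity)] at h2
    nlinarith [mul_le_mul_of_nonneg_left h1 (Nat.cast_nonneg K : (0 : ℝ) ≤ K)]
  refine ⟨K, ρ, hρ0, by linarith, fun s w hs hw => ?_⟩
  -- Scales are numbered in reverse, so that the times increase with `i`.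
  set v : ℕ → ℝ := fun i => w * ρ ^ (K - i) with hv
  have hv0 : ∀ i, 0 < v i := fun i => by simp only [hv]; positivity
  have hvsucc : ∀ i < K, v i = ρ * v (i + 1) := fun i hi => by
    simp only [hv]
    rw [show K - i = (K - (i + 1)) + 1 by omega, pow_succ]; ring
  set τ : ℕ → ℝ≥0 := fun i => (s + v i ^ 2).toNNReal with hτ
  have hτv : ∀ i, (τ i : ℝ) = s + v i ^ 2 := fun i =>
    Real.coe_toNNReal _ (by positivity)
  have hmono : Monotone τ := fun i j hij => Real.toNNReal_le_toNNReal (by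
    have : v i ≤ v j := mul_le_mul_of_nonneg_left
      (pow_le_pow_of_le_one hρ0.le (by linarith) (by omega)) hw.le
    have := hv0 i
    gcongr)
  have hind := hW.hasIndepIncrements.nat hmono
  have hfar : ∀ i < K, P {ω | v (i + 1) ≤ |W (τ i) ω - W s.toNNReal ω|}
      ≤ ENNReal.ofReal (ρ ^ 2) := fun i hi => by
    refine (measure_le_abs_increment_le hW _ _ (hv0 _)).trans (ENNReal.ofReal_le_ofReal ?_)
    rw [hτv, Real.coe_toNNReal _ hs, add_sub_cancel_left, hvsucc i hi, abs_of_nonneg (sq_nonneg _),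
      mul_pow, mul_div_assoc, div_self (by have := hv0 (i + 1); positivity), mul_one]
  have hnear : ∀ i < K, P ((fun ω => W (τ (i + 1)) ω - W (τ i) ω) ⁻¹' Iio (2 * v (i + 1))) ≤ q :=
    fun i hi => by
    have hlaw := hW.hasLaw_sub (τ (i + 1)) (τ i)
    have h1 : ρ ^ 2 ≤ 1 / 4 := by nlinarith
    have hvar : ((nndist (τ (i + 1)).1 (τ i).1 : ℝ≥0) : ℝ)
        = (v (i + 1) * Real.sqrt (1 - ρ ^ 2)) ^ 2 := by
      rw [coe_nndist, Real.dist_eq]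
      change |((τ (i + 1) : ℝ)) - (τ i : ℝ)| = _
      rw [hτv, hτv, hvsucc i hi, mul_pow (v (i + 1)), Real.sq_sqrt (by linarith), abs_of_nonneg]
      · ring
      · nlinarith [sq_nonneg (v (i + 1))]
    have hsq : 1 / 2 ≤ Real.sqrt (1 - ρ ^ 2) := Real.le_sqrt_of_sq_le (by linarith)
    have := hlaw.measure_eq (p := fun x => x < 2 * v (i + 1)) measurableSet_Iio
    calc _ = gaussianReal 0 (nndist (τ (i + 1)).1 (τ i).1) (Iio (2 * v (i + 1))) := this
      _ ≤ q := gaussianReal_Iio_le (mul_pos (hv0 _) (by linarith)) hvar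
        (by nlinarith [hv0 (i + 1)])
  -- If the path is above `-v (i+1)` at `τ i` and then gains `2 v (i+1)`, it exceeds `v (i+1) ≥ w ρ
  -- ^ K` at `τ (i+1)`. So failure needs an early large deviation or the failure of all `K`
  -- independent gains.
  have hsub : {ω | ∀ i < K, W (s + (w * ρ ^ i) ^ 2).toNNReal ω - W s.toNNReal ω < w * ρ ^ K} ⊆
      (⋃ i ∈ Finset.range K, {ω | v (i + 1) ≤ |W (τ i) ω - W s.toNNReal ω|}) ∪
      ⋂ i ∈ Finset.range K, (fun ω => W (τ (i + 1)) ω - W (τ i) ω) ⁻¹' Iio (2 * v (i + 1)) := by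
    intro ω hω
    by_contra hcon
    simp only [mem_union, mem_iUnion, mem_iInter, Finset.mem_range, Set.mem_ofPred_eq, not_or,
      not_exists, not_le, not_forall, mem_preimage, mem_Iio, not_lt] at hcon
    obtain ⟨h1, i, hi, h2⟩ := hcon
    have h3 := hω (K - (i + 1)) (by omega)
    have h4 := (abs_lt.1 (h1 i hi)).1
    have h5 : w * ρ ^ K ≤ v (i + 1) := mul_le_mul_of_nonneg_left
      (pow_le_pow_of_le_one hρ0.le (by linarith) (by omega)) hw.le
    change W (τ (i + 1)) ω - _ < _ at h3
    linarith
  calc _ ≤ _ := measure_mono hsub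
    _ ≤ _ := measure_union_le _ _
    _ ≤ ∑ i ∈ Finset.range K, ENNReal.ofReal (ρ ^ 2) + ∏ i ∈ Finset.range K, q := by
      refine add_le_add ((measure_biUnion_finset_le _ _).trans
        (Finset.sum_le_sum fun i hi => hfar i (Finset.mem_range.1 hi))) ?_
      rw [hind.measure_inter_preimage_eq_mul _ fun i _ => measurableSet_Iio]
      exact Finset.prod_le_prod' fun i hi => hnear i (Finset.mem_range.1 hi)
    _ ≤ ENNReal.ofReal (θ / 2) + ENNReal.ofReal (θ / 2) := by
      refine add_le_add ?_ ?_
      · rw [Finset.sum_const, Finset.card_range, nsmul_eq_mul, ← ENNReal.ofReal_natCast,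
          ← ENNReal.ofReal_mul (Nat.cast_nonneg K)]
        exact ENNReal.ofReal_le_ofReal hρK
      · rw [Finset.prod_const, Finset.card_range]; exact hK.le
    _ = ENNReal.ofReal θ := by
      rw [← ENNReal.ofReal_add (by positivity) (by positivity), add_halves]

end SmallBall

/-! ### The exponential factor over a short window -/

section Alpha

variable {V : ℝ → ℝ} {a b ε C s d : ℝ}

lemma intervalIntegrable_drift (hcont : ContinuousOn (drift V a b ε) (Icc 0 (endTime a b)))
    (hs : 0 ≤ s) (hsd : s + d ≤ endTime a b) {t u : ℝ} (ht : t ∈ Icc s (s + d))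
    (hu : u ∈ Icc s (s + d)) : IntervalIntegrable (drift V a b ε) volume u t :=
  (hcont.mono ((uIcc_subset_Icc hu ht).trans (Icc_subset_Icc hs hsd))).intervalIntegrable

lemma abs_alpha_div_le (hC : ∀ t ∈ Icc 0 (endTime a b), |drift V a b ε t| ≤ C)
    (hε : 0 < ε) (hs : 0 ≤ s) (hsd : s + d ≤ endTime a b) {t u : ℝ} (ht : t ∈ Icc s (s + d))
    (hu : u ∈ Icc s (s + d)) : |alpha V a b ε t u / ε| ≤ C * d / ε := by
  have hsub : uIcc u t ⊆ Icc 0 (endTime a b) :=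
    (uIcc_subset_Icc hu ht).trans (Icc_subset_Icc hs hsd)
  have h := intervalIntegral.norm_integral_le_of_norm_le_const (a := u) (b := t)
    (f := drift V a b ε) (C := C) fun z hz => hC z (hsub (uIoc_subset_uIcc hz))
  have hC0 : 0 ≤ C := (abs_nonneg _).trans (hC u (hsub left_mem_uIcc))
  have hd : |t - u| ≤ d := abs_sub_le_iff.2 ⟨by linarith [ht.2, hu.1], by linarith [ht.1, hu.2]⟩
  rw [abs_div, abs_of_pos hε]
  exact div_le_div_of_nonneg_right (h.trans (mul_le_mul_of_nonneg_left hd hC0)) hε.le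

lemma abs_exp_alpha_sub_one_le (hC : ∀ t ∈ Icc 0 (endTime a b), |drift V a b ε t| ≤ C)
    (hε : 0 < ε) (hs : 0 ≤ s) (hsd : s + d ≤ endTime a b) (hCd : C * d / ε ≤ 1) {t u : ℝ}
    (ht : t ∈ Icc s (s + d)) (hu : u ∈ Icc s (s + d)) :
    |Real.exp (alpha V a b ε t u / ε) - 1| ≤ 2 * (C * d / ε) := by
  have h := abs_alpha_div_le hC hε hs hsd ht hu
  have := Real.abs_exp_sub_one_le (h.trans hCd)
  linarith

end Alpha

/-- If a function continuous on `[s, s + d]` takes a negative value there, it takes one at a dyadic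
point of `(s, s + d]`. -/
lemma exists_dyadic_neg {F : ℝ → ℝ} {s d : ℝ} (hd : 0 < d) (hF : ContinuousOn F (Icc s (s + d)))
    {t : ℝ} (ht : t ∈ Icc s (s + d)) (hneg : F t < 0) :
    ∃ p j : ℕ, 1 ≤ j ∧ j ≤ 2 ^ p ∧ F (s + j * (d / (2 ^ p : ℕ))) < 0 := by
  obtain ⟨δ, hδ, hball⟩ := Metric.mem_nhdsWithin_iff.1 ((hF t ht) (Iio_mem_nhds hneg))
  obtain ⟨p, hp⟩ := exists_pow_lt_of_lt_one (div_pos hδ hd) (by norm_num : (1 / 2 : ℝ) < 1)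
  have hu0 : 0 ≤ (t - s) / d := div_nonneg (sub_nonneg.2 ht.1) hd.le
  have hu1 : (t - s) / d ≤ 1 := by rw [div_le_one hd]; linarith [ht.2]
  set u := (t - s) / d with hu
  have htu : t = s + u * d := by rw [hu]; field_simp; ring
  have hN : (0 : ℝ) < 2 ^ p := by positivity
  -- Rounding up and capping keeps `1 ≤ j ≤ 2 ^ p`, also at the end points, at a distance of at most
  -- one step.
  set j := min (⌊u * 2 ^ p⌋₊ + 1) (2 ^ p) with hj
  have hj1 : 1 ≤ j := le_min (by omega) Nat.one_le_two_pow
  have hj2 : j ≤ 2 ^ p := min_le_right _ _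
  have hfl := Nat.floor_le (show 0 ≤ u * 2 ^ p by positivity)
  have hlt := Nat.lt_floor_add_one (u * 2 ^ p)
  have hclose : |(j : ℝ) - u * 2 ^ p| ≤ 1 := by
    rw [hj, Nat.cast_min]
    push_cast
    rw [abs_le]
    constructor
    · have : u * 2 ^ p - 1 ≤ min ((⌊u * 2 ^ p⌋₊ : ℝ) + 1) (2 ^ p) :=
        le_min (by linarith) (by nlinarith)
      linarith
    · have := min_le_left ((⌊u * 2 ^ p⌋₊ : ℝ) + 1) (2 ^ p)
      linarith
  have hmem : s + (j : ℝ) * (d / (2 ^ p : ℕ)) ∈ Icc s (s + d) := by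
    simpa using wienerGrid_mem_Icc (s := s) (t := s + d) (by linarith) hj2
  refine ⟨p, j, hj1, hj2, hball ⟨?_, hmem⟩⟩
  rw [Metric.mem_ball, Real.dist_eq, htu]
  have h1 : s + (j : ℝ) * (d / (2 ^ p : ℕ)) - (s + u * d) = ((j : ℝ) - u * 2 ^ p) * (d / 2 ^ p) := by
    push_cast; field_simp; ring
  rw [h1, abs_mul, abs_of_pos (show 0 < d / 2 ^ p by positivity)]
  calc |(j : ℝ) - u * 2 ^ p| * (d / 2 ^ p) ≤ 1 * (d / 2 ^ p) :=
        mul_le_mul_of_nonneg_right hclose (by positivity)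
    _ = (1 / 2) ^ p * d := by rw [one_div, inv_pow]; ring
    _ < δ := by rwa [lt_div_iff₀ hd] at hp

/-! ### The process started at a given point: staying positive, and rising -/

section GaussianPart

variable {Ω : Type*} [MeasurableSpace Ω] {P : Measure Ω} {W W' : ℝ≥0 → Ω → ℝ} {V : ℝ → ℝ}
  {a b ε σ s y₀ C d : ℝ} {Y : ℝ → Ω → ℝ}

lemma IsGaussianPart.congr_process (h : IsGaussianPart W P V a b ε σ s y₀ Y)
    (hW : ∀ t, W t =ᵐ[P] W' t) : IsGaussianPart W' P V a b ε σ s y₀ Y :=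
  ⟨h.continuous, fun t ht => by
    obtain ⟨Z, hZ, hYZ⟩ := h.formula t ht
    exact ⟨Z, hZ.congr_process hW, hYZ⟩⟩

/-- Over a short time the Gaussian process is unlikely to become negative. -/
lemma IsGaussianPart.measure_sInf_neg_le [IsProbabilityMeasure P] (hW : IsPreBrownianReal W P)
    (hWm : ∀ t, Measurable (W t)) (hY : IsGaussianPart W P V a b ε σ s y₀ Y)
    (hcont : ContinuousOn (drift V a b ε) (Icc 0 (endTime a b)))
    (hC : ∀ t ∈ Icc 0 (endTime a b), |drift V a b ε t| ≤ C)
    (hε : 0 < ε) (hσ : 0 < σ) (hs : 0 ≤ s) (hd : 0 < d) (hsd : s + d ≤ endTime a b)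
    (hCd : C * d / ε ≤ 1) (hy : 0 < y₀) :
    P {ω | sInf ((fun t => Y t ω) '' Icc s (s + d)) < 0}
      ≤ ENNReal.ofReal (36 * (d * σ ^ 2) / (y₀ ^ 2 * ε)) := by
  have hsub : Icc s (s + d) ⊆ Icc s (endTime a b) := Icc_subset_Icc_right hsd
  have hmem_s : s ∈ Icc s (s + d) := ⟨le_rfl, by linarith⟩
  choose! Z hZ hYZ using hY.formula
  -- Removing `e^{α(t,s)/ε}` makes the integrand independent of the upper limit, as the maximal
  -- inequality requires, and does not affect the sign of `Y`.
  set Z' : ℝ → Ω → ℝ := fun t ω => Real.exp (-(alpha V a b ε t s / ε)) * Z t ω with hZ'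
  have hwien : ∀ t ∈ Icc s (s + d),
      IsWienerIntegral W P (fun u => Real.exp (alpha V a b ε s u / ε)) s t (Z' t) :=
    fun t ht => (hZ t (hsub ht)).const_mul ht.1 _ fun u hu => by
      have hu' : u ∈ Icc s (s + d) := ⟨hu.1, hu.2.trans ht.2⟩
      have hadd : alpha V a b ε s u + alpha V a b ε t s = alpha V a b ε t u :=
        intervalIntegral.integral_add_adjacent_intervals
          (intervalIntegrable_drift hcont hs hsd hmem_s hu')
          (intervalIntegrable_drift hcont hs hsd ht hmem_s)
      rw [← Real.exp_add, ← hadd]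
      congr 1
      ring
  have hbound : ∀ u ∈ Icc s (s + d), |Real.exp (alpha V a b ε s u / ε)| ≤ 3 := fun u hu => by
    have := abs_le.1 (abs_exp_alpha_sub_one_le hC hε hs hsd hCd hmem_s hu)
    rw [abs_of_pos (Real.exp_pos _)]
    linarith
  have hr : 0 < y₀ * Real.sqrt ε / σ := div_pos (mul_pos hy (Real.sqrt_pos.2 hε)) hσ
  have hmax := measure_exists_le_abs_wienerIntegral_dyadic hW hWm hs hd hbound hwien hr
  have hval : 4 * (3 ^ 2 * d) / (y₀ * Real.sqrt ε / σ) ^ 2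
      = 36 * (d * σ ^ 2) / (y₀ ^ 2 * ε) := by
    rw [div_pow, mul_pow, Real.sq_sqrt hε.le]
    field_simp
    ring
  rw [hval] at hmax
  refine (measure_mono_ae ?_).trans hmax
  have hgrid : ∀ p j : ℕ, j ≤ 2 ^ p → s + (j : ℝ) * (d / (2 ^ p : ℕ)) ∈ Icc s (s + d) :=
    fun p j hj => by
      simpa using wienerGrid_mem_Icc (s := s) (t := s + d) (by linarith) hj
  have hae : ∀ᵐ ω ∂P, ∀ p j : ℕ, j ≤ 2 ^ p → Y (s + j * (d / (2 ^ p : ℕ))) ω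
      = Real.exp (alpha V a b ε (s + j * (d / (2 ^ p : ℕ))) s / ε) * y₀
        + σ / Real.sqrt ε * Z (s + j * (d / (2 ^ p : ℕ))) ω := by
    rw [ae_all_iff]; intro p
    rw [ae_all_iff]; intro j
    by_cases hj : j ≤ 2 ^ p
    · filter_upwards [hYZ _ (hsub (hgrid p j hj))] with ω hω _ using hω
    · exact ae_of_all _ fun ω h => absurd h hj
  filter_upwards [hae, hY.continuous] with ω hω hωc hinf
  obtain ⟨_, ⟨t, ht, rfl⟩, htneg⟩ := (csInf_lt_iff
    ((isCompact_Icc.image_of_continuousOn (hωc.mono hsub)).bddBelow)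
    ⟨_, mem_image_of_mem _ hmem_s⟩).1 hinf
  obtain ⟨p, j, hj1, hj2, hneg⟩ := exists_dyadic_neg hd (hωc.mono hsub) ht htneg
  refine ⟨p, j, hj1, hj2, ?_⟩
  simp only [hω p j hj2] at hneg
  set t' := s + (j : ℝ) * (d / (2 ^ p : ℕ)) with ht'
  have hsqrt := Real.sqrt_pos.2 hε
  have hneg' : y₀ + σ / Real.sqrt ε * Z' t' ω < 0 := by
    have h1 : y₀ + σ / Real.sqrt ε * Z' t' ω = Real.exp (-(alpha V a b ε t' s / ε)) *
        (Real.exp (alpha V a b ε t' s / ε) * y₀ + σ / Real.sqrt ε * Z t' ω) := by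
      simp only [hZ']
      rw [mul_add, ← mul_assoc (Real.exp _) (Real.exp _), ← Real.exp_add, neg_add_cancel,
        Real.exp_zero]
      ring
    rw [h1]
    exact mul_neg_of_pos_of_neg (Real.exp_pos _) hneg
  refine le_trans ?_ (neg_le_abs _)
  rw [div_le_iff₀ hσ]
  have h2 : σ / Real.sqrt ε * Z' t' ω < -y₀ := by linarith
  rw [div_mul_eq_mul_div, div_lt_iff₀ hsqrt] at h2
  linarith

/-- Over a short time the Gaussian process is likely to exceed any level which is only a small
fraction of `σ √(d/ε)` above its starting point. -/
lemma IsGaussianPart.measure_not_exists_le [IsProbabilityMeasure P] (hW : IsPreBrownianReal W P)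
    (hWm : ∀ t, Measurable (W t)) (hY : IsGaussianPart W P V a b ε σ s y₀ Y)
    (hC : ∀ t ∈ Icc 0 (endTime a b), |drift V a b ε t| ≤ C)
    (hε : 0 < ε) (hσ : 0 < σ) (hs : 0 ≤ s) (hd : 0 < d) (hsd : s + d ≤ endTime a b)
    (hCd : C * d / ε ≤ 1) (hy : 0 ≤ y₀) {K : ℕ} {ρ θ η : ℝ} (hρ : 0 < ρ) (hρ1 : ρ < 1)
    (hθ : ∀ s w : ℝ, 0 ≤ s → 0 < w →
      P {ω | ∀ i < K, W (s + (w * ρ ^ i) ^ 2).toNNReal ω - W s.toNNReal ω < w * ρ ^ K}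
        ≤ ENNReal.ofReal θ)
    {l : ℝ → ℝ} (hl : ∀ t ∈ Icc s (s + d), l t ≤ y₀ + η)
    (hη : (η + 2 * (C * d / ε) * y₀) * Real.sqrt ε ≤ σ * (Real.sqrt d * ρ ^ K / 2)) :
    P {ω | ¬ ∃ t ∈ Icc s (s + d), l t ≤ Y t ω}
      ≤ ENNReal.ofReal θ + K * ENNReal.ofReal (64 * (C * d / ε) ^ 2 / (ρ ^ K) ^ 2) := by
  have hsub : Icc s (s + d) ⊆ Icc s (endTime a b) := Icc_subset_Icc_right hsd
  have hmem_s : s ∈ Icc s (s + d) := ⟨le_rfl, by linarith⟩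
  choose! Z hZ hYZ using hY.formula
  set w := Real.sqrt d with hw
  have hw0 : 0 < w := Real.sqrt_pos.2 hd
  have hw2 : w ^ 2 = d := Real.sq_sqrt hd.le
  set τ : ℕ → ℝ := fun i => s + (w * ρ ^ i) ^ 2 with hτ
  have hτmem : ∀ i, τ i ∈ Icc s (s + d) := fun i => by
    have h1 : (ρ ^ i) ^ 2 ≤ 1 := pow_le_one₀ (by positivity) (pow_le_one₀ hρ.le hρ1.le)
    have h2 : (w * ρ ^ i) ^ 2 = d * (ρ ^ i) ^ 2 := by rw [mul_pow, hw2]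
    constructor
    · simp only [hτ]; nlinarith [sq_nonneg (w * ρ ^ i)]
    · simp only [hτ]; rw [h2]; nlinarith
  -- Half of the level reached by Brownian motion pays for replacing `Z` by its increment; the other
  -- half must cover `η` and the drift loss `2 (C d / ε) y₀`.
  have hr : 0 < w * ρ ^ K / 2 := by positivity
  have hdev : ∀ i, P {ω | w * ρ ^ K / 2 ≤
      |Z (τ i) ω - (W (τ i).toNNReal ω - W s.toNNReal ω)|}
      ≤ ENNReal.ofReal (64 * (C * d / ε) ^ 2 / (ρ ^ K) ^ 2) := fun i => by
    refine ((hZ _ (hsub (hτmem i))).measure_le_abs_sub_increment hW hWm hs (hτmem i).1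
      (fun u hu => abs_exp_alpha_sub_one_le hC hε hs hsd hCd (hτmem i)
        ⟨hu.1, hu.2.trans (hτmem i).2⟩) hr).trans (ENNReal.ofReal_le_ofReal ?_)
    have h1 : τ i - s ≤ d := by linarith [(hτmem i).2]
    calc 4 * ((2 * (C * d / ε)) ^ 2 * (τ i - s)) / (w * ρ ^ K / 2) ^ 2
        ≤ 4 * ((2 * (C * d / ε)) ^ 2 * d) / (w * ρ ^ K / 2) ^ 2 := by gcongr
      _ = 64 * (C * d / ε) ^ 2 / (ρ ^ K) ^ 2 := by
        rw [div_pow, mul_pow w, hw2]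
        field_simp
        ring
  have hae : ∀ᵐ ω ∂P, ∀ i, Y (τ i) ω = Real.exp (alpha V a b ε (τ i) s / ε) * y₀
      + σ / Real.sqrt ε * Z (τ i) ω := ae_all_iff.2 fun i => hYZ _ (hsub (hτmem i))
  have hincl : {ω | ¬ ∃ t ∈ Icc s (s + d), l t ≤ Y t ω} ≤ᵐ[P]
      ({ω | ∀ i < K, W (s + (w * ρ ^ i) ^ 2).toNNReal ω - W s.toNNReal ω < w * ρ ^ K} ∪
        ⋃ i ∈ Finset.range K, {ω | w * ρ ^ K / 2 ≤
          |Z (τ i) ω - (W (τ i).toNNReal ω - W s.toNNReal ω)|} : Set Ω) := by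
    filter_upwards [hae] with ω hω hnot
    by_contra hcon
    change ω ∉ (_ : Set Ω) at hcon
    simp only [Set.mem_ofPred_eq, mem_iUnion, Finset.mem_range, not_or, not_forall,
      not_exists, not_le, not_lt] at hcon
    obtain ⟨⟨i, hi, h1⟩, h2⟩ := hcon
    refine hnot ⟨τ i, hτmem i, (hl _ (hτmem i)).trans ?_⟩
    have h3 := (abs_lt.1 (h2 i hi)).1
    have h4 : w * ρ ^ K / 2 ≤ Z (τ i) ω := by
      change _ ≤ W (τ i).toNNReal ω - _ at h1
      linarith
    have h5 := (abs_le.1 (abs_exp_alpha_sub_one_le hC hε hs hsd hCd (hτmem i) hmem_s)).1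
    have h6 : η + 2 * (C * d / ε) * y₀ ≤ σ / Real.sqrt ε * Z (τ i) ω := by
      rw [div_mul_eq_mul_div, le_div_iff₀ (Real.sqrt_pos.2 hε)]
      exact hη.trans (mul_le_mul_of_nonneg_left h4 hσ.le)
    rw [hω i]
    nlinarith [mul_le_mul_of_nonneg_right h5 hy]
  calc _ ≤ _ := measure_mono_ae hincl
    _ ≤ _ := measure_union_le _ _
    _ ≤ _ := by
      refine add_le_add (hθ s w hs hw0) ((measure_biUnion_finset_le _ _).trans
        ((Finset.sum_le_sum fun i _ => hdev i).trans ?_))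
      rw [Finset.sum_const, Finset.card_range, nsmul_eq_mul]

end GaussianPart

/-! ### Comparison of scales -/

section Scales

lemma MuchLess.eventually_lt {g h : ℝ → ℝ} (hgh : MuchLess g h) {δ : ℝ} (hδ : 0 < δ)
    (hpos : ∀ᶠ σ in 𝓝[>] (0 : ℝ), 0 < h σ) : ∀ᶠ σ in 𝓝[>] (0 : ℝ), g σ < δ * h σ := by
  filter_upwards [hgh.eventually_lt_const hδ, hpos] with σ h1 h2
  rwa [div_lt_iff₀ h2] at h1

/-- The hypotheses on the scales at a fixed noise intensity `σ`, with smallness parameter `δ` and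
`R = √(ε/Δ)`. -/
structure Scales (δ σ ε D d fp f R : ℝ) : Prop where
  σ_pos : 0 < σ
  ε_pos : 0 < ε
  d_pos : 0 < d
  σ_lt : σ < δ
  R_pos : 0 < R
  sq_mul : R ^ 2 * d = ε
  one_lt : 1 < δ * fp
  fp_lt : fp < δ * R
  sq_lt : R * D ^ 2 < δ * σ
  ε_lt : R * ε < δ * σ
  mul_fp_lt : σ * fp < δ
  le_f : 1 / fp ≤ f
  f_le : f ≤ fp

/-- For a fixed `δ`, each relation `≪` becomes an inequality with factor `δ`; what remains is
algebra at a single `σ`. -/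
lemma eventually_scales {ε D Δ fp f : ℝ → ℝ}
    (hpos : ∀ᶠ σ in 𝓝[>] (0 : ℝ), 0 < ε σ ∧ 0 < D σ ∧ 0 < Δ σ ∧ 0 < fp σ)
    (h₁ : MuchLess (fun _ => 1) fp)
    (h₂ : MuchLess fp (fun σ => Real.sqrt (ε σ / Δ σ)))
    (h₃ : MuchLess (fun σ => Real.sqrt (ε σ / Δ σ)) (fun σ => min (σ / D σ ^ 2) (σ / ε σ)))
    (h₄ : MuchLess fp (fun σ => 1 / σ))
    (hf : ∀ᶠ σ in 𝓝[>] (0 : ℝ), 1 / fp σ ≤ f σ ∧ f σ ≤ fp σ) {δ : ℝ} (hδ : 0 < δ) :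
    ∀ᶠ σ in 𝓝[>] (0 : ℝ),
      Scales δ σ (ε σ) (D σ) (Δ σ) (fp σ) (f σ) (Real.sqrt (ε σ / Δ σ)) := by
  have hσ : ∀ᶠ σ in 𝓝[>] (0 : ℝ), 0 < σ := self_mem_nhdsWithin
  have hσδ : ∀ᶠ σ in 𝓝[>] (0 : ℝ), σ < δ := nhdsWithin_le_nhds (Iio_mem_nhds hδ)
  filter_upwards [hpos, hf, hσ, hσδ,
    h₁.eventually_lt hδ (hpos.mono fun σ h => h.2.2.2),
    h₂.eventually_lt hδ (hpos.mono fun σ h => Real.sqrt_pos.2 (div_pos h.1 h.2.2.1)),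
    h₃.eventually_lt hδ ((hpos.and hσ).mono fun σ h =>
      lt_min (div_pos h.2 (pow_pos h.1.2.1 2)) (div_pos h.2 h.1.1)),
    h₄.eventually_lt hδ (hσ.mono fun σ h => one_div_pos.2 h)]
    with σ ⟨hε, hD, hΔ, hfp⟩ ⟨hf1, hf2⟩ hσ hσδ e1 e2 e3 e4
  have e5 := e3.trans_le (mul_le_mul_of_nonneg_left (min_le_left _ _) hδ.le)
  have e6 := e3.trans_le (mul_le_mul_of_nonneg_left (min_le_right _ _) hδ.le)
  rw [← mul_div_assoc, lt_div_iff₀ (by positivity)] at e5 e6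
  rw [mul_one_div, lt_div_iff₀ hσ] at e4
  exact
    { σ_pos := hσ
      ε_pos := hε
      d_pos := hΔ
      σ_lt := hσδ
      R_pos := Real.sqrt_pos.2 (div_pos hε hΔ)
      sq_mul := by rw [Real.sq_sqrt (div_pos hε hΔ).le, div_mul_cancel₀ _ hΔ.ne']
      one_lt := e1
      fp_lt := e2
      sq_lt := e5
      ε_lt := e6
      mul_fp_lt := by linarith
      le_f := hf1
      f_le := hf2 }

namespace Scales

variable {δ σ ε D d fp f R : ℝ}

lemma delta_pos (h : Scales δ σ ε D d fp f R) : 0 < δ := h.σ_pos.trans h.σ_lt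

lemma fp_pos (h : Scales δ σ ε D d fp f R) : 0 < fp :=
  pos_of_mul_pos_right (zero_lt_one.trans h.one_lt) h.delta_pos.le

lemma f_pos (h : Scales δ σ ε D d fp f R) : 0 < f :=
  (one_div_pos.2 h.fp_pos).trans_le h.le_f

lemma one_lt_sq_mul (h : Scales δ σ ε D d fp f R) : 1 < δ ^ 2 * R := by
  have h1 := h.one_lt
  have h2 := mul_lt_mul_of_pos_left h.fp_lt h.delta_pos
  nlinarith

/-- The lower bound `f ≥ 1/f₊` enters here: the starting height `σf` exceeds the noise `σ/R` by a
factor `1/δ`. -/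
lemma one_lt_mul_f (h : Scales δ σ ε D d fp f R) : 1 < δ * (R * f) := by
  have h1 : 1 ≤ f * fp := by
    have := h.le_f
    rwa [div_le_iff₀ h.fp_pos] at this
  have h2 := mul_lt_mul_of_pos_left h.fp_lt h.f_pos
  nlinarith

lemma one_lt_R (h : Scales δ σ ε D d fp f R) (hδ : δ ≤ 1) : 1 < R := by
  have h1 := h.one_lt_sq_mul
  have h2 : δ ^ 2 ≤ 1 := pow_le_one₀ h.delta_pos.le hδ
  nlinarith [mul_le_mul_of_nonneg_right h2 h.R_pos.le]

/-- The scale `σ f` dominates `σ/R`, which dominates `ε` and `D²`. -/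
lemma mul_add_sq_le (h : Scales δ σ ε D d fp f R) {c κ : ℝ} (hc : 0 < c)
    (hδ : (c + 1) * δ ^ 2 ≤ κ) : c * ε + D ^ 2 ≤ κ * (σ * f) := by
  have hδ0 := h.delta_pos
  have hσ := h.σ_pos
  have h1 : R * (c * ε + D ^ 2) ≤ (c + 1) * (δ * σ) := by
    nlinarith [h.sq_lt, mul_lt_mul_of_pos_left h.ε_lt hc]
  have h2 : (c + 1) * (δ * σ) ≤ (c + 1) * (δ * σ) * (δ * (R * f)) :=
    le_mul_of_one_le_right (by positivity) h.one_lt_mul_f.le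
  have h3 : (c + 1) * δ ^ 2 * (σ * (R * f)) ≤ κ * (σ * (R * f)) :=
    mul_le_mul_of_nonneg_right hδ (by have := h.R_pos; have := h.f_pos; positivity)
  refine le_of_mul_le_mul_left ?_ h.R_pos
  linarith

lemma d_le (h : Scales δ σ ε D d fp f R) (hδ : δ ≤ 1) : d ≤ ε := by
  have h1 := h.one_lt_R hδ
  rw [← h.sq_mul]
  nlinarith [h.d_pos, one_le_pow₀ h1.le (n := 2)]

lemma ε_lt_delta (h : Scales δ σ ε D d fp f R) (hδ : δ ≤ 1) : ε < δ := by
  have h1 := h.one_lt_R hδ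
  nlinarith [h.ε_lt, h.ε_pos, h.σ_lt, h.σ_pos, h.delta_pos]

/-- `Δ/ε = R⁻²`, and `R > δ⁻²`. -/
lemma d_div_le (h : Scales δ σ ε D d fp f R) (hδ : δ ≤ 1) : d / ε ≤ δ := by
  have hR := h.R_pos
  have h1 := h.one_lt_R hδ
  have h2 := h.one_lt_sq_mul
  have hδ0 := h.delta_pos
  rw [div_le_iff₀ h.ε_pos, ← h.sq_mul, ← mul_assoc]
  refine le_mul_of_one_le_left h.d_pos.le ?_
  nlinarith [mul_pos hδ0 hR]

end Scales

end Scales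

/-! ### Position of the window -/

section Geometry

variable {V : ℝ → ℝ} {a b c δ σ ε D d fp f R : ℝ}

lemma mul_one_add_tStar (ha : 0 < a) (σ f : ℝ) : a * (1 + tStar a b σ f) = b - σ * f := by
  rw [tStar]; field_simp; ring

/-- The window `[t*, t* + Δ]` lies in `[0, T]`, and `T ≤ b/a - 1`. -/
lemma Scales.window_subset (h : Scales δ σ ε D d fp f R) (ha : 0 < a) (hab : a < b) (hc : 0 < c)
    (hδ1 : δ ≤ 1) (hδb : (c + 1) * δ < b - a) (hδc : (a + c + 1) * δ ^ 2 ≤ 1)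
    (hcont : ContinuousOn (detPath V a b ε) (Icc 0 (endTime a b)))
    (htube : ∀ t ∈ Icc 0 (endTime a b), a * (1 + t) - c * ε ≤ detPath V a b ε t ∧
      detPath V a b ε t ≤ a * (1 + t)) :
    0 ≤ tStar a b σ f ∧ tStar a b σ f + d ≤ hitZero V a b ε D ∧
      hitZero V a b ε D ≤ endTime a b := by
  have hδ0 := h.delta_pos
  have hT : 0 ≤ endTime a b := by
    rw [endTime, sub_nonneg, le_div_iff₀ ha]; linarith
  have haT : a * (1 + endTime a b) = b := by rw [endTime]; field_simp; ring
  have hstar := mul_one_add_tStar (b := b) ha σ f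
  have hσf : σ * f < b - a := by
    have h1 := mul_le_mul_of_nonneg_left h.f_le h.σ_pos.le
    have h2 := h.mul_fp_lt
    nlinarith
  have hsmall := h.mul_add_sq_le hc (κ := 1) (by nlinarith)
  have hsmall' : a * d + (c * ε + D ^ 2) ≤ σ * f := by
    have h1 := h.mul_add_sq_le (c := a + c) (by positivity) hδc
    nlinarith [h.d_le hδ1]
  -- The infimum of the empty set would be `0`, so a zero is needed: the curve is nonnegative at
  -- time `0` and nonpositive at the end.
  have hne : {t | t ∈ Icc 0 (endTime a b) ∧ -dMinus V a b ε t - D ^ 2 = 0}.Nonempty := by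
    have hφ : ContinuousOn (fun t => -dMinus V a b ε t - D ^ 2) (Icc 0 (endTime a b)) := by
      simp only [dMinus]; fun_prop
    have h0 := (htube 0 ⟨le_rfl, hT⟩).1
    have h1 := (htube (endTime a b) ⟨hT, le_rfl⟩).2
    obtain ⟨t, ht, ht0⟩ := intermediate_value_Icc' hT hφ
      (show (0 : ℝ) ∈ Icc _ _ from ⟨by
        simp only [dMinus]; nlinarith [sq_nonneg D], by
        simp only [dMinus]; nlinarith⟩)
    exact ⟨t, ht, ht0⟩
  refine ⟨?_, le_csInf hne ?_, ?_⟩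
  · have : 0 ≤ a * tStar a b σ f := by linarith
    exact nonneg_of_mul_nonneg_right this ha
  · rintro t ⟨ht, ht0⟩
    have h1 := (htube t ht).1
    simp only [dMinus] at ht0
    have : a * (tStar a b σ f + d) ≤ a * t := by nlinarith
    exact le_of_mul_le_mul_left this ha
  · obtain ⟨t, ht⟩ := hne
    exact (csInf_le ⟨0, fun t ht => ht.1.1⟩ ht).trans ht.1.2

end Geometry

/-! ### The two estimates at a fixed noise intensity -/

section Main

variable {Ω : Type*} [MeasurableSpace Ω] {P : Measure Ω} [IsProbabilityMeasure P]
  {W : ℝ≥0 → Ω → ℝ} {V : ℝ → ℝ} {a b c C δ σ ε D d fp f R : ℝ} {Y : ℝ → Ω → ℝ}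

lemma Scales.start_bounds (h : Scales δ σ ε D d fp f R) (ha : 0 < a) (hc : 0 < c)
    (hδc : (c + 1) * δ ^ 2 ≤ 1 / 2)
    (hmem : tStar a b σ f ∈ Icc 0 (endTime a b))
    (htube : ∀ t ∈ Icc 0 (endTime a b), a * (1 + t) - c * ε ≤ detPath V a b ε t ∧
      detPath V a b ε t ≤ a * (1 + t)) :
    σ * f / 2 ≤ -dMinus V a b ε (tStar a b σ f) - D ^ 2 ∧
      -dMinus V a b ε (tStar a b σ f) - D ^ 2 ≤ σ * f ∧
      σ * f - (c * ε + D ^ 2) ≤ -dMinus V a b ε (tStar a b σ f) - D ^ 2 := by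
  have hstar := mul_one_add_tStar (b := b) ha σ f
  have h1 := htube _ hmem
  have h2 := h.mul_add_sq_le hc hδc
  simp only [dMinus]
  refine ⟨?_, ?_, ?_⟩ <;> nlinarith [sq_nonneg D]

lemma Scales.measure_sInf_neg_le (h : Scales δ σ ε D d fp f R) (hW : IsPreBrownianReal W P)
    (hWm : ∀ t, Measurable (W t))
    (hY : IsGaussianPart W P V a b ε σ (tStar a b σ f)
      (-dMinus V a b ε (tStar a b σ f) - D ^ 2) Y)
    (hcont : ContinuousOn (drift V a b ε) (Icc 0 (endTime a b)))
    (hC : ∀ t ∈ Icc 0 (endTime a b), |drift V a b ε t| ≤ C)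
    (hs : 0 ≤ tStar a b σ f) (hsd : tStar a b σ f + d ≤ endTime a b) (hCd : C * d / ε ≤ 1)
    (hy : σ * f / 2 ≤ -dMinus V a b ε (tStar a b σ f) - D ^ 2) :
    P {ω | sInf ((fun t => Y t ω) '' Icc (tStar a b σ f) (tStar a b σ f + d)) < 0}
      ≤ ENNReal.ofReal (144 * δ ^ 2) := by
  have hσ := h.σ_pos
  have hf := h.f_pos
  have hd := h.d_pos
  have hR := h.R_pos
  have hε := h.ε_pos
  refine (hY.measure_sInf_neg_le hW hWm hcont hC h.ε_pos h.σ_pos hs h.d_pos hsd hCd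
    (lt_of_lt_of_le (by positivity) hy)).trans (ENNReal.ofReal_le_ofReal ?_)
  calc 36 * (d * σ ^ 2) / ((-dMinus V a b ε (tStar a b σ f) - D ^ 2) ^ 2 * ε)
      ≤ 36 * (d * σ ^ 2) / ((σ * f / 2) ^ 2 * ε) := by gcongr
    _ = 144 / (R * f) ^ 2 := by rw [← h.sq_mul]; field_simp; norm_num
    _ ≤ 144 * δ ^ 2 := by
      rw [div_le_iff₀ (by positivity)]
      have h1 : 1 ≤ (δ * (R * f)) ^ 2 := one_le_pow₀ h.one_lt_mul_f.le
      nlinarith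

lemma Scales.measure_not_exists_le (h : Scales δ σ ε D d fp f R) (hW : IsPreBrownianReal W P)
    (hWm : ∀ t, Measurable (W t))
    (hY : IsGaussianPart W P V a b ε σ (tStar a b σ f)
      (-dMinus V a b ε (tStar a b σ f) - D ^ 2) Y)
    (hC : ∀ t ∈ Icc 0 (endTime a b), |drift V a b ε t| ≤ C) (ha : 0 < a) (hc : 0 < c)
    (hC0 : 0 < C)
    (hs : 0 ≤ tStar a b σ f) (hsd : tStar a b σ f + d ≤ endTime a b) (hδ1 : δ ≤ 1)
    (hδC : C * δ ≤ 1) (hδc : (c + 1) * δ ^ 2 ≤ 1 / 2)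
    (htube : ∀ t ∈ Icc 0 (endTime a b), a * (1 + t) - c * ε ≤ detPath V a b ε t ∧
      detPath V a b ε t ≤ a * (1 + t))
    {K : ℕ} {ρ θ : ℝ} (hρ : 0 < ρ) (hρ1 : ρ < 1)
    (hθ : ∀ s w : ℝ, 0 ≤ s → 0 < w →
      P {ω | ∀ i < K, W (s + (w * ρ ^ i) ^ 2).toNNReal ω - W s.toNNReal ω < w * ρ ^ K}
        ≤ ENNReal.ofReal θ)
    (hδρ : (2 * (c + 1) + 2 * C) * δ ≤ ρ ^ K / 2) :
    P {ω | ¬ ∃ t ∈ Icc (tStar a b σ f) (tStar a b σ f + d), dPlus V a b ε t + D ^ 2 ≤ Y t ω}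
      ≤ ENNReal.ofReal θ + K * ENNReal.ofReal (64 * (C * δ) ^ 2 / (ρ ^ K) ^ 2) := by
  have hσ := h.σ_pos
  have hf := h.f_pos
  have hd := h.d_pos
  have hR := h.R_pos
  have hε := h.ε_pos
  have hδ0 := h.delta_pos
  have hstar := mul_one_add_tStar (b := b) ha σ f
  obtain ⟨hy1, hy2, hy3⟩ := h.start_bounds ha hc hδc ⟨hs, by linarith⟩ htube
  have hCdδ : C * d / ε ≤ C * δ := by
    rw [mul_div_assoc]; exact mul_le_mul_of_nonneg_left (h.d_div_le hδ1) hC0.le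
  have hCd0 : 0 ≤ C * d / ε := by positivity
  have hy0 : 0 ≤ -dMinus V a b ε (tStar a b σ f) - D ^ 2 :=
    le_trans (by positivity) hy1
  -- One `cε + D²` in `η` comes from the starting point below `σf`, the other from the boundary
  -- above it.
  refine (hY.measure_not_exists_le hW hWm hC hε hσ hs hd hsd (hCdδ.trans hδC) hy0 hρ hρ1 hθ
    (l := fun t => dPlus V a b ε t + D ^ 2) (η := 2 * (c * ε + D ^ 2)) ?_ ?_).trans ?_
  · intro t ht
    have h1 := (htube t ⟨hs.trans ht.1, ht.2.trans hsd⟩).1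
    have h2 := mul_le_mul_of_nonneg_left ht.1 ha.le
    simp only [dPlus]
    nlinarith
  · have hsqrt : Real.sqrt ε = R * Real.sqrt d := by
      rw [← h.sq_mul, Real.sqrt_mul (sq_nonneg R), Real.sqrt_sq hR.le]
    have h1 : R * (2 * (c * ε + D ^ 2)) ≤ 2 * (c + 1) * δ * σ := by
      nlinarith [h.sq_lt, mul_lt_mul_of_pos_left h.ε_lt hc]
    have h2 : R * (2 * (C * d / ε) * (-dMinus V a b ε (tStar a b σ f) - D ^ 2))
        ≤ 2 * C * δ * σ := by
      have e1 : C * d / ε = C / R ^ 2 := by rw [← h.sq_mul]; field_simp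
      -- Here `f ≤ f₊ ≪ R` makes the drift loss small against the noise.
      have e2 : -dMinus V a b ε (tStar a b σ f) - D ^ 2 ≤ σ * (δ * R) :=
        hy2.trans (mul_le_mul_of_nonneg_left (h.f_le.trans h.fp_lt.le) hσ.le)
      calc _ ≤ R * (2 * (C / R ^ 2) * (σ * (δ * R))) := by rw [e1]; gcongr
        _ = 2 * C * δ * σ := by field_simp
    rw [hsqrt]
    have h3 : (2 * (c * ε + D ^ 2) + 2 * (C * d / ε) *
        (-dMinus V a b ε (tStar a b σ f) - D ^ 2)) * R ≤ σ * (ρ ^ K / 2) := by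
      nlinarith
    calc _ = (2 * (c * ε + D ^ 2) + 2 * (C * d / ε) *
        (-dMinus V a b ε (tStar a b σ f) - D ^ 2)) * R * Real.sqrt d := by ring
      _ ≤ σ * (ρ ^ K / 2) * Real.sqrt d :=
        mul_le_mul_of_nonneg_right h3 (Real.sqrt_nonneg d)
      _ = _ := by ring
  · gcongr

end Main

/-- A smallness requirement `k * δ ≤ m` with `m > 0` holds for all small `δ > 0`. -/
lemma eventually_mul_le (k : ℝ) {m : ℝ} (hm : 0 < m) : ∀ᶠ δ in 𝓝[>] (0 : ℝ), k * δ ≤ m := by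
  have : Tendsto (fun δ : ℝ => k * δ) (𝓝[>] 0) (𝓝 0) := by
    have : Tendsto (fun δ : ℝ => k * δ) (𝓝 0) (𝓝 (k * 0)) := tendsto_id.const_mul k
    rw [mul_zero] at this
    exact this.mono_left nhdsWithin_le_nhds
  exact this.eventually_le_const hm

end BreakingChain

theorem mainTheorem3
    {Ω : Type*} [MeasurableSpace Ω] (P : Measure Ω) [IsProbabilityMeasure P]
    (W : ℝ≥0 → Ω → ℝ) (hW : IsBrownianReal W P)
    (U V : ℝ → ℝ) (a b a₀ u₀ : ℝ)
    (hU : BreakingChain.IsPairPotential U a b a₀ u₀)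
    (hV : BreakingChain.IsConvexExtension V U b a₀ u₀)
    (ε D Δ fp f : ℝ → ℝ)
    (hpos : ∀ᶠ σ in 𝓝[>] (0 : ℝ), 0 < ε σ ∧ 0 < D σ ∧ 0 < Δ σ ∧ 0 < fp σ)
    (h₁ : BreakingChain.MuchLess (fun _ => 1) fp)
    (h₂ : BreakingChain.MuchLess fp (fun σ => Real.sqrt (ε σ / Δ σ)))
    (h₃ : BreakingChain.MuchLess (fun σ => Real.sqrt (ε σ / Δ σ))
      (fun σ => min (σ / D σ ^ 2) (σ / ε σ)))
    (h₄ : BreakingChain.MuchLess fp (fun σ => 1 / σ))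
    (hf : ∀ᶠ σ in 𝓝[>] (0 : ℝ), 1 / fp σ ≤ f σ ∧ f σ ≤ fp σ)
    (y : ℝ → ℝ → Ω → ℝ)
    (hy : ∀ᶠ σ in 𝓝[>] (0 : ℝ),
      BreakingChain.IsGaussianPart W P V a b (ε σ) σ (BreakingChain.tStar a b σ (f σ))
        (-BreakingChain.dMinus V a b (ε σ) (BreakingChain.tStar a b σ (f σ)) - D σ ^ 2) (y σ)) :
    (∀ᶠ σ in 𝓝[>] (0 : ℝ),
      Icc (BreakingChain.tStar a b σ (f σ)) (BreakingChain.tStar a b σ (f σ) + Δ σ) ⊆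
        Icc 0 (BreakingChain.hitZero V a b (ε σ) (D σ))) ∧
    Tendsto (fun σ => P {ω | ∃ t ∈ Icc (BreakingChain.tStar a b σ (f σ))
        (BreakingChain.tStar a b σ (f σ) + Δ σ),
          BreakingChain.dPlus V a b (ε σ) t + D σ ^ 2 ≤ y σ t ω}) (𝓝[>] 0) (𝓝 1) ∧
    Tendsto (fun σ => P {ω | sInf ((fun t => y σ t ω) ''
        Icc (BreakingChain.tStar a b σ (f σ)) (BreakingChain.tStar a b σ (f σ) + Δ σ)) < 0})
      (𝓝[>] 0) (𝓝 0) := by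
  obtain ⟨c, hc, C, hC0, ε₀, hε₀, hdet⟩ := BreakingChain.exists_detPath_bounds hU hV
  have hab := hU.a_lt_b
  have ha : 0 < a := hU.a₀_pos.trans hU.a₀_lt
  set W' : ℝ≥0 → Ω → ℝ := fun t => (hW.aemeasurable t).mk (W t) with hW'def
  have hWW' : ∀ t, W t =ᵐ[P] W' t := fun t => (hW.aemeasurable t).ae_eq_mk
  have hWm : ∀ t, Measurable (W' t) := fun t => (hW.aemeasurable t).measurable_mk
  have hW' : IsPreBrownianReal W' P := hW.toIsPreBrownianReal.congr hWW'
  have hscales := fun δ : ℝ => BreakingChain.eventually_scales hpos h₁ h₂ h₃ h₄ hf (δ := δ)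
  have hsq : ∀ {k m δ : ℝ}, 0 ≤ k → 0 < δ → δ ≤ 1 → k * δ ≤ m → k * δ ^ 2 ≤ m :=
    fun {k m δ} hk h0 h1 hm => le_trans (mul_le_mul_of_nonneg_left (by nlinarith) hk) hm
  have hsmall : ∀ᶠ δ in 𝓝[>] (0 : ℝ), 0 < δ ∧ δ ≤ 1 ∧ δ < ε₀ ∧ (c + 1) * δ < b - a ∧
      (a + c + 1) * δ ^ 2 ≤ 1 ∧ (c + 1) * δ ^ 2 ≤ 1 / 2 ∧ C * δ ≤ 1 := by
    filter_upwards [self_mem_nhdsWithin, BreakingChain.eventually_mul_le 1 one_pos,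
      BreakingChain.eventually_mul_le 1 (half_pos hε₀),
      BreakingChain.eventually_mul_le (c + 1) (half_pos (sub_pos.2 hab)),
      BreakingChain.eventually_mul_le (a + c + 1) one_pos,
      BreakingChain.eventually_mul_le (c + 1) one_half_pos,
      BreakingChain.eventually_mul_le C one_pos] with δ e0 e1 e2 e3 e4 e5 e6
    have e0 : 0 < δ := e0
    rw [one_mul] at e1
    exact ⟨e0, e1, by linarith, by linarith, hsq (by positivity) e0 e1 e4,
      hsq (by positivity) e0 e1 e5, e6⟩
  have hwindow : ∀ δ : ℝ, 0 < δ ∧ δ ≤ 1 ∧ δ < ε₀ ∧ (c + 1) * δ < b - a ∧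
      (a + c + 1) * δ ^ 2 ≤ 1 ∧ (c + 1) * δ ^ 2 ≤ 1 / 2 ∧ C * δ ≤ 1 → ∀ σ,
      BreakingChain.Scales δ σ (ε σ) (D σ) (Δ σ) (fp σ) (f σ) (Real.sqrt (ε σ / Δ σ)) →
      0 ≤ BreakingChain.tStar a b σ (f σ) ∧
      BreakingChain.tStar a b σ (f σ) + Δ σ ≤ BreakingChain.hitZero V a b (ε σ) (D σ) ∧
      BreakingChain.hitZero V a b (ε σ) (D σ) ≤ BreakingChain.endTime a b := by
    rintro δ ⟨-, e1, e2, e3, e4, -, -⟩ σ h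
    have hd := hdet (ε σ) h.ε_pos ((h.ε_lt_delta e1).trans e2)
    exact h.window_subset ha hab hc e1 e3 e4 hd.1 hd.2.1
  refine ⟨?_, ?_, ?_⟩
  · obtain ⟨δ, hδ⟩ := hsmall.exists
    filter_upwards [hscales δ hδ.1] with σ h
    have hw := hwindow δ hδ σ h
    exact Icc_subset_Icc hw.1 hw.2.1
  · have hbad : Tendsto (fun σ => P {ω | ¬ ∃ t ∈ Icc (BreakingChain.tStar a b σ (f σ))
        (BreakingChain.tStar a b σ (f σ) + Δ σ),
          BreakingChain.dPlus V a b (ε σ) t + D σ ^ 2 ≤ y σ t ω}) (𝓝[>] 0) (𝓝 0) := by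
      refine ENNReal.tendsto_nhds_zero.2 fun e he => ?_
      obtain ⟨θ, hθ0, hθe⟩ := ENNReal.lt_iff_exists_nnreal_btwn.1 he
      have hθ0 : (0 : ℝ) < θ := by exact_mod_cast hθ0
      -- `K` and `ρ` depend on `θ` alone; `δ` is chosen after them, and `σ` last.
      obtain ⟨K, ρ, hρ, hρ1, hball⟩ :=
        BreakingChain.exists_measure_forall_increment_lt_le hW' (half_pos hθ0)
      obtain ⟨δ, hδ, hδρ, hδK⟩ := (hsmall.and
        ((BreakingChain.eventually_mul_le (2 * (c + 1) + 2 * C)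
          (show 0 < ρ ^ K / 2 by positivity)).and
        (BreakingChain.eventually_mul_le (K * (64 * C ^ 2 / (ρ ^ K) ^ 2)) (half_pos hθ0)))).exists
      filter_upwards [hscales δ hδ.1, hy] with σ h hyσ
      have hw := hwindow δ hδ σ h
      have hd := hdet (ε σ) h.ε_pos ((h.ε_lt_delta hδ.2.1).trans hδ.2.2.1)
      refine (h.measure_not_exists_le hW' hWm (hyσ.congr_process hWW') hd.2.2.2 ha hc hC0 hw.1
        (hw.2.1.trans hw.2.2) hδ.2.1 hδ.2.2.2.2.2.2 hδ.2.2.2.2.2.1 hd.2.1 hρ hρ1 hball hδρ).trans ?_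
      refine le_trans ?_ hθe.le
      rw [← ENNReal.ofReal_natCast, ← ENNReal.ofReal_mul (Nat.cast_nonneg K),
        ← ENNReal.ofReal_add (by positivity) (by positivity), ← ENNReal.ofReal_coe_nnreal]
      refine ENNReal.ofReal_le_ofReal ?_
      have := hsq (by positivity) hδ.1 hδ.2.1 hδK
      have e : (K : ℝ) * (64 * (C * δ) ^ 2 / (ρ ^ K) ^ 2)
          = K * (64 * C ^ 2 / (ρ ^ K) ^ 2) * δ ^ 2 := by ring
      rw [e]
      linarith
    have hlim := ENNReal.Tendsto.sub (tendsto_const_nhds (x := (1 : ℝ≥0∞))) hbad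
      (Or.inl ENNReal.one_ne_top)
    rw [tsub_zero] at hlim
    refine tendsto_of_tendsto_of_tendsto_of_le_of_le hlim tendsto_const_nhds (fun σ => ?_)
      fun σ => prob_le_one
    -- Subadditivity gives the bound without measurability of the event.
    refine tsub_le_iff_right.2 ?_
    rw [← measure_univ (μ := P)]
    refine (measure_mono fun ω _ => ?_).trans (measure_union_le _ _)
    exact em _
  · refine ENNReal.tendsto_nhds_zero.2 fun e he => ?_
    obtain ⟨θ, hθ0, hθe⟩ := ENNReal.lt_iff_exists_nnreal_btwn.1 he
    have hθ0 : (0 : ℝ) < θ := by exact_mod_cast hθ0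
    obtain ⟨δ, hδ, hδθ⟩ := (hsmall.and (BreakingChain.eventually_mul_le 144 hθ0)).exists
    filter_upwards [hscales δ hδ.1, hy] with σ h hyσ
    have hw := hwindow δ hδ σ h
    have hd := hdet (ε σ) h.ε_pos ((h.ε_lt_delta hδ.2.1).trans hδ.2.2.1)
    have hsd := hw.2.1.trans hw.2.2
    have hCd : C * Δ σ / ε σ ≤ 1 := by
      rw [mul_div_assoc]
      exact (mul_le_mul_of_nonneg_left (h.d_div_le hδ.2.1) hC0.le).trans hδ.2.2.2.2.2.2
    have hst := h.start_bounds ha hc hδ.2.2.2.2.2.1 ⟨hw.1, by linarith [h.d_pos]⟩ hd.2.1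
    refine (h.measure_sInf_neg_le hW' hWm (hyσ.congr_process hWW') hd.2.2.1 hd.2.2.2 hw.1 hsd hCd
      hst.1).trans (le_trans ?_ hθe.le)
    rw [← ENNReal.ofReal_coe_nnreal]
    exact ENNReal.ofReal_le_ofReal (hsq (by norm_num) hδ.1 hδ.2.1 hδθ)
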